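/- Let $0<k<1$, $T>0$, $\sigma>0$, and let $$\widehat Q=\{(x,t):\ 0<t<T,\ 0<x<1+kt\},$$ with lateral boundary $\widehat\Sigma=\widehat\Sigma_0\cup\widehat\Sigma_0^*$, $\widehat\Sigma_0=\{0\}\times(0,T)$, $\widehat\Sigma_0^*=\{(1+kt,t):0<t<T\}$. Let $\widehat\Sigma_0=\widehat\Sigma_1\cup\widehat\Sigma_2$ with $\widehat\Sigma_1,\widehat\Sigma_2$ measurable (for instance disjoint, or both equal to $\widehat\Sigma_0$). Let $u_0\in L^2(0,1)$, $u_1\in H^{-1}(0,1)$, $u_2\in L^2(\widehat Q)$. For $\widetilde w_i\in L^2(\widehat\Sigma_i)$, $i=1,2$, extended by zero to $\widehat\Sigma_0$, let $u=u(\widetilde w_1,\widetilde w_2)\in L^2(\widehat Q)$ be the solution in the sense of transposition of $$u_{tt}-u_{xx}=0\ \text{in }\widehat Q,\qquad u=\widetilde w_1+\widetilde w_2\ \text{on }\widehat\Sigma_0,\qquad u=0\ \text{on }\widehat\Sigma_0^*,\qquad u(\cdot,0)=u_0,\ u_t(\cdot,0)=u_1\ \text{in }(0,1),$$ which exists and is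 unique, and put $$\widetilde J_2(\widetilde w_1,\widetilde w_2)=\frac12\iint_{\widehat Q}\bigl(u(\widetilde w_1,\widetilde w_2)-u_2\bigr)^2\,dx\,dt+\frac\sigma2\int_{\widehat\Sigma_2}\widetilde w_2^2\,d\widehat\Sigma .$$ Then for each leader $\widetilde w_1\in L^2(\widehat\Sigma_1)$ there exists a unique follower $\widetilde w_2\in L^2(\widehat\Sigma_2)$ (the Nash equilibrium) with $$\widetilde J_2(\widetilde w_1,\widetilde w_2)=\inf_{\widehat w_2\in L^2(\widehat\Sigma_2)}\widetilde J_2(\widetilde w_1,\widehat w_2).$$ Moreover $$\widetilde w_2=\frac1\sigma\,\frac{\partial p}{\partial\nu}\quad\text{on }\widehat\Sigma_2,$$ where $\partial p/\partial\nu=-p_x(0,\cdot)\in L^2(0,T)$ is the outward normal derivative of $p$ on $\widehat\Sigma_0$ and $\{u,p\}$ is the unique solution of the optimality system $$\begin{cases}u_{tt}-u_{xx}=0,\qquad p_{tt}-p_{xx}=u-u_2&\text{in }\widehat Q,\\ u=\widetilde w_1\mathbf 1_{\widehat\Sigma_1}+\dfrac1\sigma\dfrac{\partial p}{\partial\nu}\mathbf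 1_{\widehat\Sigma_2}\ \text{on }\widehat\Sigma_0,\qquad u=0\ \text{on }\widehat\Sigma_0^*,\\ p=0&\text{on }\widehat\Sigma,\\ u(\cdot,0)=u_0,\ u_t(\cdot,0)=u_1&\text{in }(0,1),\\ p(\cdot,T)=p_t(\cdot,T)=0&\text{in }(0,1+kT),\end{cases}$$ $u\in L^2(\widehat Q)$ being a solution in the sense of transposition and $p\in H^1(\widehat Q)$ a weak solution whose normal derivative on $\widehat\Sigma_0$ is in $L^2(0,T)$; and $u=u(\widetilde w_1,\widetilde w_2)$. -/

import Mathlib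

open MeasureTheory Set

noncomputable section

namespace MovingWave

/-- Real-valued `L²` functions (modulo a.e. equality) on a set, for Lebesgue measure. -/
abbrev L2 {α : Type} [MeasureSpace α] (s : Set α) : Type := Lp ℝ 2 (volume.restrict s)

/-- The moving domain `{(x, t) : 0 < t < T, 0 < x < 1 + k t}`; points are written `(x, t)`. -/
def Q (k T : ℝ) : Set (ℝ × ℝ) := {z | 0 < z.2 ∧ z.2 < T ∧ 0 < z.1 ∧ z.1 < 1 + k * z.2}

/-- Partial derivative in the space variable. -/
def dx (φ : ℝ × ℝ → ℝ) (z : ℝ × ℝ) : ℝ := fderiv ℝ φ z (1, 0)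

/-- Partial derivative in the time variable. -/
def dt (φ : ℝ × ℝ → ℝ) (z : ℝ × ℝ) : ℝ := fderiv ℝ φ z (0, 1)

/-- The wave operator `φ_tt - φ_xx`. -/
def box (φ : ℝ × ℝ → ℝ) (z : ℝ × ℝ) : ℝ := dt (dt φ) z - dx (dx φ) z

/-- The function vanishes on the fixed end `x = 0`. -/
def ZeroLeft (T : ℝ) (φ : ℝ × ℝ → ℝ) : Prop := ∀ t ∈ Icc 0 T, φ (0, t) = 0

/-- The function vanishes on the moving end `x = 1 + k t`. -/
def ZeroRight (k T : ℝ) (φ : ℝ × ℝ → ℝ) : Prop := ∀ t ∈ Icc 0 T, φ (1 + k * t, t) = 0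

/-- The function vanishes on the slice of the closed domain at time `t`. -/
def ZeroAt (k t : ℝ) (φ : ℝ × ℝ → ℝ) : Prop := ∀ x ∈ Icc 0 (1 + k * t), φ (x, t) = 0

/-! ### The spaces `H¹₀(0,1)` and `H⁻¹(0,1)` -/

/-- The pairs `(v, v')` with `v` of class `C¹` vanishing at `0` and `1`. -/
def H10Smooth : Submodule ℝ (L2 (Ioo (0 : ℝ) 1) × L2 (Ioo (0 : ℝ) 1)) where
  carrier := {z | ∃ v : ℝ → ℝ, ContDiff ℝ 1 v ∧ v 0 = 0 ∧ v 1 = 0 ∧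
    z.1 =ᵐ[volume.restrict (Ioo (0 : ℝ) 1)] v ∧
    z.2 =ᵐ[volume.restrict (Ioo (0 : ℝ) 1)] deriv v}
  zero_mem' := by
    refine ⟨fun _ => 0, contDiff_const, rfl, rfl, Lp.coeFn_zero _ _ _, ?_⟩
    filter_upwards [Lp.coeFn_zero ℝ 2 (volume.restrict (Ioo (0 : ℝ) 1))] with x hx
    simpa using hx
  add_mem' := by
    rintro a b ⟨v, hv, v0, v1, h1, h2⟩ ⟨w, hw, w0, w1, h3, h4⟩
    refine ⟨v + w, hv.add hw, by simp [v0, w0], by simp [v1, w1], ?_, ?_⟩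
    · exact (Lp.coeFn_add _ _).trans (h1.add h3)
    · refine ((Lp.coeFn_add _ _).trans (h2.add h4)).trans (Filter.Eventually.of_forall ?_)
      intro x
      exact (deriv_add (hv.differentiable (by simp) x) (hw.differentiable (by simp) x)).symm
  smul_mem' := by
    rintro c a ⟨v, hv, v0, v1, h1, h2⟩
    refine ⟨c • v, contDiff_const.smul hv, by simp [v0], by simp [v1], ?_, ?_⟩
    · exact (Lp.coeFn_smul _ _).trans (h1.const_smul c)
    · refine ((Lp.coeFn_smul _ _).trans (h2.const_smul c)).trans (Filter.Eventually.of_forall ?_)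
      intro x
      exact (deriv_const_smul c (hv.differentiable (by simp) x)).symm

/-- `H¹₀(0,1)`, each function being recorded together with its weak derivative: the closure, for
the `H¹` topology, of the `C¹` functions that vanish at both ends. -/
def H10 : Submodule ℝ (L2 (Ioo (0 : ℝ) 1) × L2 (Ioo (0 : ℝ) 1)) := H10Smooth.topologicalClosure

/-- `H⁻¹(0,1)`, the topological dual of `H¹₀(0,1)`. -/
abbrev HMinusOne : Type := H10 →L[ℝ] ℝ

theorem memLp_of_continuous {v : ℝ → ℝ} (hv : Continuous v) :
    MemLp v 2 (volume.restrict (Ioo (0 : ℝ) 1)) := by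
  obtain ⟨C, hC⟩ := isCompact_Icc.exists_bound_of_continuousOn
    (s := Icc (0 : ℝ) 1) hv.continuousOn
  refine MemLp.of_bound hv.aestronglyMeasurable C ?_
  filter_upwards [ae_restrict_mem measurableSet_Ioo] with x hx
  exact hC x (Ioo_subset_Icc_self hx)

/-- A `C¹` function vanishing at `0` and `1`, as an element of `H¹₀(0,1)`. -/
def toH10 (v : ℝ → ℝ) (hv : ContDiff ℝ 1 v) (h0 : v 0 = 0) (h1 : v 1 = 0) : H10 :=
  ⟨(MemLp.toLp v (memLp_of_continuous hv.continuous),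
    MemLp.toLp (deriv v) (memLp_of_continuous (hv.continuous_deriv (le_refl _)))),
    H10Smooth.le_topologicalClosure
      ⟨v, hv, h0, h1, MemLp.coeFn_toLp (memLp_of_continuous hv.continuous),
        MemLp.coeFn_toLp (memLp_of_continuous (hv.continuous_deriv (le_refl _)))⟩⟩

/-! ### The state, by transposition -/

/-- The test functions for the state: `φ = 0` on the lateral boundary and
`φ(T) = φ_t(T) = 0`. -/
structure StateTest (k T : ℝ) where
  toFun : ℝ × ℝ → ℝ
  smooth : ContDiff ℝ 2 toFun
  time_nonneg : 0 ≤ T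
  left : ZeroLeft T toFun
  right : ZeroRight k T toFun
  final : ZeroAt k T toFun
  final_dt : ZeroAt k T (dt toFun)

/-- The initial value `φ(·, 0)`, as an element of `H¹₀(0,1)`. -/
def StateTest.initial {k T : ℝ} (φ : StateTest k T) : H10 :=
  toH10 (fun x => φ.toFun (x, 0))
    ((φ.smooth.of_le (by norm_num)).comp (contDiff_id.prodMk contDiff_const))
    (φ.left 0 ⟨le_refl _, φ.time_nonneg⟩)
    (by simpa using φ.right 0 ⟨le_refl _, φ.time_nonneg⟩)

/-- `u ∈ L²(Q)` solves, in the sense of transposition,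
`u_tt - u_xx = 0` in `Q`, `u = w` on `x = 0`, `u = 0` on `x = 1 + k t`,
`u(0) = u₀`, `u_t(0) = u₁`. -/
def IsTranspositionSolution (k T : ℝ) (u₀ : L2 (Ioo (0 : ℝ) 1)) (u₁ : HMinusOne)
    (w : ℝ → ℝ) (u : L2 (Q k T)) : Prop :=
  ∀ φ : StateTest k T,
    ∫ z in Q k T, u z * box φ.toFun z =
      u₁ φ.initial - (∫ x in Ioo (0 : ℝ) 1, u₀ x * dt φ.toFun (x, 0))
        + ∫ t in Ioo 0 T, w t * dx φ.toFun (0, t)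

/-- The control on `x = 0` made of `w₁` acting on `S₁` and `w₂` acting on `S₂`
(extended by zero and added up). -/
def boundaryControl (S₁ S₂ : Set ℝ) (w₁ w₂ : ℝ → ℝ) (t : ℝ) : ℝ :=
  S₁.indicator w₁ t + S₂.indicator w₂ t

open Classical in
/-- The state `u(w₁, w₂)` (`0` by convention, should there be none). -/
def state (k T : ℝ) (S₁ S₂ : Set ℝ) (u₀ : L2 (Ioo (0 : ℝ) 1)) (u₁ : HMinusOne)
    (w₁ : L2 S₁) (w₂ : L2 S₂) : L2 (Q k T) :=
  if h : ∃ u, IsTranspositionSolution k T u₀ u₁ (boundaryControl S₁ S₂ w₁ w₂) u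
  then h.choose else 0

/-! ### The follower's cost and the Nash equilibrium -/

/-- The secondary cost functional
`J₂(w₁, w₂) = ½ ∬_Q (u(w₁, w₂) - u₂)² + (σ/2) ∫_{S₂} w₂²`. -/
def J₂ (k T σ : ℝ) (S₁ S₂ : Set ℝ) (u₀ : L2 (Ioo (0 : ℝ) 1)) (u₁ : HMinusOne)
    (u₂ : L2 (Q k T)) (w₁ : L2 S₁) (w₂ : L2 S₂) : ℝ :=
  1 / 2 * (∫ z in Q k T, (state k T S₁ S₂ u₀ u₁ w₁ w₂ z - u₂ z) ^ 2)
    + σ / 2 * ∫ t in S₂, (w₂ t) ^ 2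

/-- `w₂` is a Nash equilibrium for the leader `w₁`: it minimizes `J₂(w₁, ·)` over `L²(S₂)`. -/
def IsNashEquilibrium (k T σ : ℝ) (S₁ S₂ : Set ℝ) (u₀ : L2 (Ioo (0 : ℝ) 1)) (u₁ : HMinusOne)
    (u₂ : L2 (Q k T)) (w₁ : L2 S₁) (w₂ : L2 S₂) : Prop :=
  ∀ w : L2 S₂, J₂ k T σ S₁ S₂ u₀ u₁ u₂ w₁ w₂ ≤ J₂ k T σ S₁ S₂ u₀ u₁ u₂ w₁ w

/-! ### The adjoint state -/

/-- The triples `(φ, φ_x, φ_t)` with `φ` of class `C¹` vanishing on the lateral boundary and at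
`t = T`. -/
def AdjointSmooth (k T : ℝ) : Submodule ℝ (L2 (Q k T) × L2 (Q k T) × L2 (Q k T)) where
  carrier := {z | ∃ φ : ℝ × ℝ → ℝ, ContDiff ℝ 1 φ ∧
    ZeroLeft T φ ∧ ZeroRight k T φ ∧ ZeroAt k T φ ∧
    z.1 =ᵐ[volume.restrict (Q k T)] φ ∧
    z.2.1 =ᵐ[volume.restrict (Q k T)] dx φ ∧
    z.2.2 =ᵐ[volume.restrict (Q k T)] dt φ}
  zero_mem' := by
    refine ⟨fun _ => 0, contDiff_const, fun _ _ => rfl, fun _ _ => rfl, fun _ _ => rfl,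
      Lp.coeFn_zero _ _ _, ?_, ?_⟩ <;>
    · filter_upwards [Lp.coeFn_zero ℝ 2 (volume.restrict (Q k T))] with x hx
      simpa [dx, dt] using hx
  add_mem' := by
    rintro a b ⟨v, hv, l, r, f, h1, h2, h3⟩ ⟨w, hw, l', r', f', h1', h2', h3'⟩
    refine ⟨v + w, hv.add hw, fun t ht => by simp [l t ht, l' t ht],
      fun t ht => by simp [r t ht, r' t ht], fun x hx => by simp [f x hx, f' x hx],
      (Lp.coeFn_add _ _).trans (h1.add h1'), ?_, ?_⟩
    · refine ((Lp.coeFn_add _ _).trans (h2.add h2')).trans (Filter.Eventually.of_forall ?_)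
      intro z
      simp [dx, fderiv_add (hv.differentiable (by simp) z) (hw.differentiable (by simp) z)]
    · refine ((Lp.coeFn_add _ _).trans (h3.add h3')).trans (Filter.Eventually.of_forall ?_)
      intro z
      simp [dt, fderiv_add (hv.differentiable (by simp) z) (hw.differentiable (by simp) z)]
  smul_mem' := by
    rintro c a ⟨v, hv, l, r, f, h1, h2, h3⟩
    refine ⟨c • v, contDiff_const.smul hv, fun t ht => by simp [l t ht],
      fun t ht => by simp [r t ht], fun x hx => by simp [f x hx],
      (Lp.coeFn_smul _ _).trans (h1.const_smul c), ?_, ?_⟩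
    · refine ((Lp.coeFn_smul _ _).trans (h2.const_smul c)).trans (Filter.Eventually.of_forall ?_)
      intro z
      simp [dx, fderiv_const_smul (hv.differentiable (by simp) z) c]
    · refine ((Lp.coeFn_smul _ _).trans (h3.const_smul c)).trans (Filter.Eventually.of_forall ?_)
      intro z
      simp [dt, fderiv_const_smul (hv.differentiable (by simp) z) c]

/-- The functions `p ∈ H¹(Q)` with zero trace on the lateral boundary and at `t = T`, recorded
as `(p, p_x, p_t)`: the closure in `H¹(Q)` of the `C¹` functions that vanish there. -/
def AdjointSpace (k T : ℝ) : Submodule ℝ (L2 (Q k T) × L2 (Q k T) × L2 (Q k T)) :=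
  (AdjointSmooth k T).topologicalClosure

/-- `p` is the weak (finite energy) solution of `p_tt - p_xx = f` in `Q`, `p = 0` on the lateral
boundary, `p(T) = p_t(T) = 0`. The conditions on `p` itself are in the space; `p_t(T) = 0` is
expressed by test functions that need not vanish at `t = T`. -/
def IsAdjointState (k T : ℝ) (f : ℝ × ℝ → ℝ) (p : AdjointSpace k T) : Prop :=
  ∀ ψ : ℝ × ℝ → ℝ, ContDiff ℝ 1 ψ → ZeroLeft T ψ → ZeroRight k T ψ → ZeroAt k 0 ψ →
    (∫ z in Q k T, (p.1.2.1 z * dx ψ z - p.1.2.2 z * dt ψ z)) = ∫ z in Q k T, f z * ψ z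

/-- `g ∈ L²(0,T)` is the trace of `p_x` on `x = 0`, where `p_tt - p_xx = f` and
`p_t(T) = 0`: Green's formula holds with `g`, for test functions that need not vanish
on `x = 0`. -/
def IsTraceDx (k T : ℝ) (f : ℝ × ℝ → ℝ) (p : AdjointSpace k T) (g : L2 (Ioo 0 T)) : Prop :=
  ∀ ψ : ℝ × ℝ → ℝ, ContDiff ℝ 1 ψ → ZeroRight k T ψ → ZeroAt k 0 ψ →
    (∫ z in Q k T, (p.1.2.1 z * dx ψ z - p.1.2.2 z * dt ψ z))
      + (∫ t in Ioo 0 T, g t * ψ (0, t)) = ∫ z in Q k T, f z * ψ z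

/-- The optimality system for `{u, p}`, where `g` is the trace of `p_x` on `x = 0`. The outward
normal derivative of `p` there is `-g`, and `u = (1/σ) (-g)` is imposed on `S₂`. -/
def IsOptimalitySystem (k T σ : ℝ) (S₁ S₂ : Set ℝ) (u₀ : L2 (Ioo (0 : ℝ) 1)) (u₁ : HMinusOne)
    (u₂ : L2 (Q k T)) (w₁ : L2 S₁) (u : L2 (Q k T)) (p : AdjointSpace k T)
    (g : L2 (Ioo 0 T)) : Prop :=
  IsAdjointState k T (fun z => u z - u₂ z) p ∧
  IsTraceDx k T (fun z => u z - u₂ z) p g ∧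
  IsTranspositionSolution k T u₀ u₁ (boundaryControl S₁ S₂ w₁ (fun t => 1 / σ * (-g t))) u

end MovingWave

end

/-!
The argument is a duality argument around one estimate and one density statement for the smooth
test functions of the backward problem, i.e. the `C²` functions `φ` vanishing on the lateral
boundary with `φ(T) = φ_t(T) = 0`.

*Estimate* (`energy_estimate`). Applying the divergence theorem on the moving domain
(`divergence_Q`) to a weighted combination of `(φ_t + φ_x)²`, `(φ_t - φ_x)²` and `φ²` bounds the
norms of `φ`, `φ_x`, `φ_t` in `L²(Q)` and at `t = 0`, and also of the trace `φ_x(0, ·)`, by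
`‖□φ‖`. The weights give the right sign to the boundary terms at both ends since the moving end is
timelike, `k < 1`.

*Density* (`denseRange_boxL2`). The functions `□φ` are dense in `L²(Q)`. In the characteristic
coordinates `ξ = t + 1/k - x`, `η = t + 1/k + x` the domain lies in the sector `ξ < η < c ξ` with
`c = (1 + k) / (1 - k)`, and the reflections in its two sides generate a group of scalings and
exchanges of `ξ` and `η` that preserves the wave equation. A source `α(ξ) β(η)` supported in `Q` is
solved by a finite sum over this group (`imageSum`), which is `C²` on the whole plane, and Lebesgue's
differentiation theorem on characteristic squares shows that such products span a dense subspace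
(`ae_eq_zero_of_charProd`).

Consequently `□φ ↦ (φ, φ_x, φ_t, φ_x(0, ·))` extends to a bounded operator on `L²(Q)`
(`adjointOp`), which produces the adjoint states and their traces. Adjoint states are unique because
the same images also solve the forward problem with a dense set of sources
(`IsAdjointState.unique`). By Riesz representation the state is an affine function of the control
whose linear part is the adjoint of the trace operator (`isTranspositionSolution_iff`).
Hence the follower's cost is `‖B w + d‖² / 2 + σ ‖w‖² / 2` with `B` bounded; it has exactly one
minimizer, the solution of the Euler equation `B* (B w + d) + σ w = 0`, and since `B*` is the trace
operator followed by the restriction to `S₂`, this equation is the optimality system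
(`isOptimalitySystem_iff`).
-/

noncomputable section

namespace MovingWave

/-! ### Integration over the moving domain -/

theorem isOpen_Q (k T : ℝ) : IsOpen (Q k T) := by
  unfold Q
  refine (isOpen_lt continuous_const continuous_snd).inter <|
    (isOpen_lt continuous_snd continuous_const).inter <|
    (isOpen_lt continuous_const continuous_fst).inter (isOpen_lt continuous_fst (by fun_prop))

theorem Q_subset_Icc {k T : ℝ} (hk : 0 < k) : Q k T ⊆ Icc (0, 0) (1 + k * T, T) := by
  rintro ⟨x, t⟩ ⟨h1, h2, h3, h4⟩
  simp only at h1 h2 h3 h4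
  exact ⟨⟨h3.le, h1.le⟩, ⟨by simp only; nlinarith, h2.le⟩⟩

theorem isBounded_Q {k T : ℝ} (hk : 0 < k) : Bornology.IsBounded (Q k T) :=
  Metric.isBounded_Icc _ _ |>.subset (Q_subset_Icc hk)

/-- A continuous function is square integrable on a bounded set. -/
theorem _root_.Continuous.memLp_two_restrict {α : Type} [MetricSpace α] [ProperSpace α]
    [MeasureSpace α] [OpensMeasurableSpace α]
    [IsFiniteMeasureOnCompacts (volume : Measure α)] {v : α → ℝ} (hv : Continuous v)
    {s : Set α} (hs : Bornology.IsBounded s) :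
    MemLp v 2 (volume.restrict s) := by
  have hK := hs.isCompact_closure
  obtain ⟨C, hC⟩ := hK.exists_bound_of_continuousOn hv.continuousOn
  have : IsFiniteMeasure (volume.restrict (closure s)) := ⟨by
    simpa using hK.measure_lt_top⟩
  have h : MemLp v 2 (volume.restrict (closure s)) := by
    refine MemLp.of_bound hv.aestronglyMeasurable C ?_
    filter_upwards [ae_restrict_mem isClosed_closure.measurableSet] with x hx
    exact hC x hx
  exact h.mono_measure (Measure.restrict_mono subset_closure le_rfl)

theorem _root_.Continuous.integrableOn_of_isBounded {α : Type} [MetricSpace α] [ProperSpace α]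
    [MeasureSpace α] [OpensMeasurableSpace α]
    [IsFiniteMeasureOnCompacts (volume : Measure α)] {v : α → ℝ} (hv : Continuous v)
    {s : Set α} (hs : Bornology.IsBounded s) : IntegrableOn v s :=
  (hv.continuousOn.integrableOn_compact hs.isCompact_closure).mono_set subset_closure

theorem setIntegral_Q {k T : ℝ} (hk : 0 < k) (hT : 0 < T) {F : ℝ × ℝ → ℝ} (hF : Continuous F) :
    ∫ z in Q k T, F z = ∫ t in (0 : ℝ)..T, ∫ x in (0 : ℝ)..(1 + k * t), F (x, t) := by
  have hQ := (isOpen_Q k T).measurableSet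
  rw [← integral_indicator hQ, Measure.volume_eq_prod,
    integral_prod_symm _ (by
      rw [← Measure.volume_eq_prod]
      exact (hF.integrableOn_of_isBounded (isBounded_Q hk)).integrable_indicator hQ),
    intervalIntegral.integral_of_le hT.le, integral_Ioc_eq_integral_Ioo,
    ← integral_indicator measurableSet_Ioo]
  refine integral_congr_ae (Filter.Eventually.of_forall fun t => ?_)
  by_cases ht : t ∈ Ioo 0 T
  · have h1 : (0 : ℝ) ≤ 1 + k * t := by nlinarith [ht.1]
    simp only [indicator_of_mem ht]
    rw [intervalIntegral.integral_of_le h1, integral_Ioc_eq_integral_Ioo,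
      ← integral_indicator measurableSet_Ioo]
    refine integral_congr_ae (Filter.Eventually.of_forall fun x => ?_)
    simp only [indicator, Q, mem_ofPred_eq, mem_Ioo]
    have := ht.1; have := ht.2
    simp_all
  · simp only [indicator_of_notMem ht]
    refine integral_eq_zero_of_ae (Filter.Eventually.of_forall fun x => ?_)
    exact indicator_of_notMem (fun h => ht ⟨h.1, h.2.1⟩) _

/-- The divergence theorem on the moving domain; the outward normal at the moving end is
proportional to `(1, -k)`. -/
theorem divergence_Q {k T : ℝ} (hk : 0 < k) (hT : 0 < T) {X Y : ℝ × ℝ → ℝ}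
    (hX : ContDiff ℝ 1 X) (hY : ContDiff ℝ 1 Y) :
    ∫ z in Q k T, (dx X z + dt Y z) =
      (∫ x in (0 : ℝ)..(1 + k * T), Y (x, T)) - (∫ x in (0 : ℝ)..1, Y (x, 0))
        + (∫ t in (0 : ℝ)..T, (X (1 + k * t, t) - k * Y (1 + k * t, t)))
        - ∫ t in (0 : ℝ)..T, X (0, t) := by
  have hX' : Continuous (fderiv ℝ X) := hX.continuous_fderiv (by simp)
  have hY' : Continuous (fderiv ℝ Y) := hY.continuous_fderiv (by simp)
  have hXc := hX.continuous
  have hYc := hY.continuous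
  have hXd : Continuous (dx X) := by unfold dx; fun_prop
  have hYd : Continuous (dt Y) := by unfold dt; fun_prop
  -- straighten the domain: `x = (1 + k t) y` with `(t, y)` in a rectangle
  let m : ℝ × ℝ → ℝ × ℝ := fun p => ((1 + k * p.1) * p.2, p.1)
  let m' : ℝ × ℝ → (ℝ × ℝ →L[ℝ] ℝ × ℝ) := fun p =>
    (((1 + k * p.1) • ContinuousLinearMap.snd ℝ ℝ ℝ +
      p.2 • (k • ContinuousLinearMap.fst ℝ ℝ ℝ)).prod (ContinuousLinearMap.fst ℝ ℝ ℝ))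
  have hl : ∀ p : ℝ × ℝ, HasFDerivAt (fun p : ℝ × ℝ => 1 + k * p.1)
      (k • ContinuousLinearMap.fst ℝ ℝ ℝ) p := fun p =>
    ((hasFDerivAt_fst (𝕜 := ℝ) (p := p)).const_mul k).const_add 1
  have hm : ∀ p, HasFDerivAt m (m' p) p := fun p =>
    ((hl p).mul hasFDerivAt_snd).prodMk hasFDerivAt_fst
  have hmc : Continuous m := by fun_prop
  have hXm : ∀ p, HasFDerivAt (fun p => X (m p)) ((fderiv ℝ X (m p)).comp (m' p)) p := fun p =>
    ((hX.differentiable (by simp) (m p)).hasFDerivAt).comp p (hm p)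
  have hYm : ∀ p, HasFDerivAt (fun p => Y (m p)) ((fderiv ℝ Y (m p)).comp (m' p)) p := fun p =>
    ((hY.differentiable (by simp) (m p)).hasFDerivAt).comp p (hm p)
  obtain ⟨f', g', hf, hg, key⟩ : ∃ f' g' : ℝ × ℝ → (ℝ × ℝ →L[ℝ] ℝ),
      (∀ p, HasFDerivAt (fun p : ℝ × ℝ => (1 + k * p.1) * Y (m p)) (f' p) p) ∧
      (∀ p, HasFDerivAt (fun p : ℝ × ℝ => X (m p) - k * p.2 * Y (m p)) (g' p) p) ∧
      ∀ p, f' p (1, 0) + g' p (0, 1) = (1 + k * p.1) * (dx X (m p) + dt Y (m p)) := by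
    refine ⟨_, _, fun p => (hl p).mul (hYm p), fun p => (hXm p).sub
      (((hasFDerivAt_snd (𝕜 := ℝ) (p := p)).const_mul k).mul (hYm p)), ?_⟩
    intro p
    have e1 : m' p (1, 0) = (p.2 * k) • ((1, 0) : ℝ × ℝ) + (0, 1) := by simp [m']
    have e2 : m' p (0, 1) = (1 + k * p.1) • ((1, 0) : ℝ × ℝ) := by simp [m']
    simp only [add_apply, sub_apply, smul_apply, ContinuousLinearMap.comp_apply, e1, e2,
      map_add, map_smul, smul_eq_mul, ContinuousLinearMap.coe_fst', ContinuousLinearMap.coe_snd',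
      dx, dt]
    ring
  have hc : Continuous fun p => f' p (1, 0) + g' p (0, 1) := by
    simp only [key]
    fun_prop
  have hdiv := integral2_divergence_prod_of_hasFDerivAt
    (fun p : ℝ × ℝ => (1 + k * p.1) * Y (m p)) (fun p => X (m p) - k * p.2 * Y (m p))
    f' g' 0 0 T 1 (by fun_prop) (by fun_prop) (fun p _ => hf p) (fun p _ => hg p)
    (hc.continuousOn.integrableOn_compact (isCompact_uIcc.prod isCompact_uIcc))
  simp only [key] at hdiv
  rw [setIntegral_Q hk hT (by fun_prop)]
  have hstr : ∀ (G : ℝ × ℝ → ℝ) (t : ℝ), ∫ x in (0 : ℝ)..(1 + k * t), G (x, t) =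
      ∫ y in (0 : ℝ)..1, (1 + k * t) * G ((1 + k * t) * y, t) := by
    intro G t
    rw [intervalIntegral.integral_const_mul, ← smul_eq_mul (1 + k * t),
      intervalIntegral.smul_integral_comp_mul_left (fun x => G (x, t))]
    simp
  simp only [hstr (fun z => dx X z + dt Y z)]
  rw [show (∫ x in (0 : ℝ)..1, Y (x, 0)) = ∫ x in (0 : ℝ)..(1 + k * 0), Y (x, 0) by simp,
    hstr Y, hstr Y]
  simp only [m] at hdiv
  rw [hdiv]
  simp
  ring

/-! ### Calculus for the wave operator -/

theorem contDiff_dx {n : WithTop ℕ∞} {φ : ℝ × ℝ → ℝ} (hφ : ContDiff ℝ (n + 1) φ) :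
    ContDiff ℝ n (dx φ) := (hφ.fderiv_right le_rfl).clm_apply contDiff_const

theorem contDiff_dt {n : WithTop ℕ∞} {φ : ℝ × ℝ → ℝ} (hφ : ContDiff ℝ (n + 1) φ) :
    ContDiff ℝ n (dt φ) := (hφ.fderiv_right le_rfl).clm_apply contDiff_const

theorem contDiff_one_dx {φ : ℝ × ℝ → ℝ} (hφ : ContDiff ℝ 2 φ) : ContDiff ℝ 1 (dx φ) :=
  contDiff_dx (by norm_num; exact hφ)

theorem contDiff_one_dt {φ : ℝ × ℝ → ℝ} (hφ : ContDiff ℝ 2 φ) : ContDiff ℝ 1 (dt φ) :=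
  contDiff_dt (by norm_num; exact hφ)

theorem continuous_dx {φ : ℝ × ℝ → ℝ} (hφ : ContDiff ℝ 1 φ) : Continuous (dx φ) :=
  (contDiff_dx (n := 0) (by simpa using hφ)).continuous

theorem continuous_dt {φ : ℝ × ℝ → ℝ} (hφ : ContDiff ℝ 1 φ) : Continuous (dt φ) :=
  (contDiff_dt (n := 0) (by simpa using hφ)).continuous

theorem continuous_box {φ : ℝ × ℝ → ℝ} (hφ : ContDiff ℝ 2 φ) : Continuous (box φ) :=
  (continuous_dt (contDiff_one_dt hφ)).sub (continuous_dx (contDiff_one_dx hφ))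

theorem dx_add {φ ψ : ℝ × ℝ → ℝ} (hφ : ContDiff ℝ 1 φ) (hψ : ContDiff ℝ 1 ψ) :
    dx (φ + ψ) = dx φ + dx ψ := by
  ext z
  simp [dx, fderiv_add (hφ.differentiable (by simp) z) (hψ.differentiable (by simp) z)]

theorem dt_add {φ ψ : ℝ × ℝ → ℝ} (hφ : ContDiff ℝ 1 φ) (hψ : ContDiff ℝ 1 ψ) :
    dt (φ + ψ) = dt φ + dt ψ := by
  ext z
  simp [dt, fderiv_add (hφ.differentiable (by simp) z) (hψ.differentiable (by simp) z)]

theorem dx_smul (c : ℝ) {φ : ℝ × ℝ → ℝ} (hφ : ContDiff ℝ 1 φ) : dx (c • φ) = c • dx φ := by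
  ext z
  simp [dx, fderiv_const_smul (hφ.differentiable (by simp) z) c]

theorem dt_smul (c : ℝ) {φ : ℝ × ℝ → ℝ} (hφ : ContDiff ℝ 1 φ) : dt (c • φ) = c • dt φ := by
  ext z
  simp [dt, fderiv_const_smul (hφ.differentiable (by simp) z) c]

theorem box_add {φ ψ : ℝ × ℝ → ℝ} (hφ : ContDiff ℝ 2 φ) (hψ : ContDiff ℝ 2 ψ) :
    box (φ + ψ) = box φ + box ψ := by
  have h1 := hφ.of_le (show (1 : WithTop ℕ∞) ≤ 2 by norm_num)
  have h2 := hψ.of_le (show (1 : WithTop ℕ∞) ≤ 2 by norm_num)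
  ext z
  simp only [box, dx_add h1 h2, dt_add h1 h2, dx_add (contDiff_one_dx hφ) (contDiff_one_dx hψ),
    dt_add (contDiff_one_dt hφ) (contDiff_one_dt hψ), Pi.add_apply]
  ring

theorem box_smul (c : ℝ) {φ : ℝ × ℝ → ℝ} (hφ : ContDiff ℝ 2 φ) :
    box (c • φ) = c • box φ := by
  have h1 := hφ.of_le (show (1 : WithTop ℕ∞) ≤ 2 by norm_num)
  ext z
  simp only [box, dx_smul c h1, dt_smul c h1, dx_smul c (contDiff_one_dx hφ),
    dt_smul c (contDiff_one_dt hφ), Pi.smul_apply, smul_eq_mul]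
  ring

theorem dt_dx_comm {φ : ℝ × ℝ → ℝ} (hφ : ContDiff ℝ 2 φ) (z : ℝ × ℝ) :
    dt (dx φ) z = dx (dt φ) z := by
  have hd : DifferentiableAt ℝ (fderiv ℝ φ) z :=
    (hφ.fderiv_right (m := 1) (by norm_num)).differentiable (by simp) z
  have hs : IsSymmSndFDerivAt ℝ φ z :=
    hφ.contDiffAt.isSymmSndFDerivAt (by simp)
  have e : ∀ v w : ℝ × ℝ, fderiv ℝ (fun y => fderiv ℝ φ y v) z w = fderiv ℝ (fderiv ℝ φ) z w v := by
    intro v w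
    have := (hd.hasFDerivAt.clm_apply (hasFDerivAt_const v z)).fderiv
    rw [this]
    simp
  change fderiv ℝ (fun y => fderiv ℝ φ y (1, 0)) z (0, 1) =
    fderiv ℝ (fun y => fderiv ℝ φ y (0, 1)) z (1, 0)
  rw [e, e]
  exact hs.eq _ _

/-- A function vanishing along a line near a point has zero derivative there in the direction of
the line. -/
theorem fderiv_apply_eq_zero_of_line {φ : ℝ × ℝ → ℝ} {a v : ℝ × ℝ} {s : ℝ}
    (hφ : DifferentiableAt ℝ φ (a + s • v)) (h : ∀ᶠ r in nhds s, φ (a + r • v) = 0) :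
    fderiv ℝ φ (a + s • v) v = 0 := by
  have h1 : HasDerivAt (fun r : ℝ => a + r • v) v s := by
    simpa using ((hasDerivAt_id s).smul_const v).const_add a
  have h2 := hφ.hasFDerivAt.comp_hasDerivAt s h1
  have h3 : HasDerivAt (φ ∘ fun r : ℝ => a + r • v) 0 s :=
    (hasDerivAt_const s (0 : ℝ)).congr_of_eventuallyEq h
  exact h2.unique h3

theorem ZeroLeft.dt_eq_zero {T : ℝ} {φ : ℝ × ℝ → ℝ} (h : ZeroLeft T φ) (hφ : ContDiff ℝ 1 φ)
    {t : ℝ} (ht : t ∈ Ioo 0 T) : dt φ (0, t) = 0 := by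
  have := fderiv_apply_eq_zero_of_line (a := (0, 0)) (v := (0, 1)) (s := t)
    (hφ.differentiable (by simp) _) (by
      filter_upwards [Ioo_mem_nhds ht.1 ht.2] with r hr
      simpa using h r (Ioo_subset_Icc_self hr))
  simpa [dt] using this

theorem ZeroRight.dt_eq {k T : ℝ} {φ : ℝ × ℝ → ℝ} (h : ZeroRight k T φ) (hφ : ContDiff ℝ 1 φ)
    {t : ℝ} (ht : t ∈ Ioo 0 T) : dt φ (1 + k * t, t) = -k * dx φ (1 + k * t, t) := by
  have := fderiv_apply_eq_zero_of_line (a := (1, 0)) (v := (k, 1)) (s := t)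
    (hφ.differentiable (by simp) _) (by
      filter_upwards [Ioo_mem_nhds ht.1 ht.2] with r hr
      simpa [mul_comm] using h r (Ioo_subset_Icc_self hr))
  rw [show ((k, 1) : ℝ × ℝ) = k • (1, 0) + (0, 1) by simp, map_add, map_smul] at this
  simp only [dt, dx]
  simp [mul_comm t k] at this
  linarith

theorem ZeroAt.dx_eq_zero {k t : ℝ} {φ : ℝ × ℝ → ℝ} (h : ZeroAt k t φ) (hφ : ContDiff ℝ 1 φ)
    {x : ℝ} (hx : x ∈ Ioo 0 (1 + k * t)) : dx φ (x, t) = 0 := by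
  have := fderiv_apply_eq_zero_of_line (a := (0, t)) (v := (1, 0)) (s := x)
    (hφ.differentiable (by simp) _) (by
      filter_upwards [Ioo_mem_nhds hx.1 hx.2] with r hr
      simpa using h r (Ioo_subset_Icc_self hr))
  simpa [dx] using this

/-- Green's formula on the moving domain, for functions `ψ` that vanish at the moving end. -/
theorem green_Q {k T : ℝ} (hk : 0 < k) (hT : 0 < T) {φ ψ : ℝ × ℝ → ℝ}
    (hφ : ContDiff ℝ 2 φ) (hψ : ContDiff ℝ 1 ψ) (hψr : ZeroRight k T ψ) :
    (∫ z in Q k T, (dx φ z * dx ψ z - dt φ z * dt ψ z))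
        + ∫ t in Ioo 0 T, dx φ (0, t) * ψ (0, t) =
      (∫ z in Q k T, box φ z * ψ z) + (∫ x in (0 : ℝ)..1, dt φ (x, 0) * ψ (x, 0))
        - ∫ x in (0 : ℝ)..(1 + k * T), dt φ (x, T) * ψ (x, T) := by
  have hx := contDiff_one_dx hφ
  have ht := contDiff_one_dt hφ
  have h := divergence_Q hk hT (X := fun z => dx φ z * ψ z) (Y := fun z => -(dt φ z * ψ z))
    (hx.mul hψ) (ht.mul hψ).neg
  have e : ∀ z, dx (fun z => dx φ z * ψ z) z + dt (fun z => -(dt φ z * ψ z)) z =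
      (dx φ z * dx ψ z - dt φ z * dt ψ z) - box φ z * ψ z := by
    intro z
    have h1 := (hx.differentiable (by simp) z).hasFDerivAt
    have h2 := (ht.differentiable (by simp) z).hasFDerivAt
    have h3 := (hψ.differentiable (by simp) z).hasFDerivAt
    have e1 := (h1.mul h3).fderiv
    have e2 := (h2.mul h3).neg.fderiv
    change fderiv ℝ (dx φ * ψ) z (1, 0) + fderiv ℝ (-(dt φ * ψ)) z (0, 1) = _
    rw [e1, e2]
    simp only [box, dx, dt, add_apply, smul_apply, neg_apply, smul_eq_mul]
    ring
  have hb := isBounded_Q (T := T) hk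
  have cx := hx.continuous
  have ct := ht.continuous
  have cψ := hψ.continuous
  have cψx := continuous_dx hψ
  have cψt := continuous_dt hψ
  have cb := continuous_box hφ
  simp only [e] at h
  rw [integral_sub (Continuous.integrableOn_of_isBounded (by fun_prop) hb)
    (Continuous.integrableOn_of_isBounded (by fun_prop) hb)] at h
  have hr : ∫ t in (0 : ℝ)..T, (dx φ (1 + k * t, t) * ψ (1 + k * t, t)
      - k * -(dt φ (1 + k * t, t) * ψ (1 + k * t, t))) = 0 := by
    rw [intervalIntegral.integral_congr (g := fun _ => 0), intervalIntegral.integral_zero]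
    intro t ht
    rw [uIcc_of_le hT.le] at ht
    simp [hψr t ht]
  rw [hr, intervalIntegral.integral_neg, intervalIntegral.integral_neg,
    intervalIntegral.integral_of_le hT.le, integral_Ioc_eq_integral_Ioo] at h
  linarith

/-! ### The energy estimate -/

/-- The pointwise divergence of the energy field: `a = φ_t + φ_x` and `b = φ_t - φ_x` are
transported along the two families of characteristics, with source `□φ`. -/
theorem divergence_energy {φ : ℝ × ℝ → ℝ} (hφ : ContDiff ℝ 2 φ) (c μ : ℝ) (z : ℝ × ℝ) :
    dx (fun z => Real.exp (μ * z.2) * (2 * (dt φ z - dx φ z) ^ 2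
        - (1 + 2 * c * z.1) * (dt φ z + dx φ z) ^ 2)) z
      + dt (fun z => Real.exp (μ * z.2) * ((1 + 2 * c * z.1) * (dt φ z + dx φ z) ^ 2
        + 2 * (dt φ z - dx φ z) ^ 2 + φ z ^ 2)) z =
    Real.exp (μ * z.2) * (2 * ((1 + 2 * c * z.1) * (dt φ z + dx φ z)
        + 2 * (dt φ z - dx φ z)) * box φ z
      + (μ * (1 + 2 * c * z.1) - 2 * c) * (dt φ z + dx φ z) ^ 2
      + 2 * μ * (dt φ z - dx φ z) ^ 2 + μ * φ z ^ 2 + 2 * φ z * dt φ z) := by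
  have hx := ((contDiff_one_dx hφ).differentiable (by simp) z).hasFDerivAt
  have ht := ((contDiff_one_dt hφ).differentiable (by simp) z).hasFDerivAt
  have h0 := (hφ.differentiable (by simp) z).hasFDerivAt
  have he : HasFDerivAt (fun z : ℝ × ℝ => Real.exp (μ * z.2)) _ z :=
    (((hasFDerivAt_snd (𝕜 := ℝ) (E := ℝ) (F := ℝ) (p := z)).const_mul μ).exp)
  have hw : HasFDerivAt (fun z : ℝ × ℝ => 1 + 2 * c * z.1) _ z :=
    ((hasFDerivAt_fst (𝕜 := ℝ) (E := ℝ) (F := ℝ) (p := z)).const_mul (2 * c)).const_add 1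
  have ha : HasFDerivAt (fun z => (dt φ z + dx φ z) ^ 2) _ z := (ht.add hx).pow 2
  have hb : HasFDerivAt (fun z => (dt φ z - dx φ z) ^ 2) _ z := (ht.sub hx).pow 2
  have e1 : HasFDerivAt (fun z => Real.exp (μ * z.2) * (2 * (dt φ z - dx φ z) ^ 2
        - (1 + 2 * c * z.1) * (dt φ z + dx φ z) ^ 2)) _ z :=
    he.mul ((hb.const_mul 2).sub (hw.mul ha))
  have e2 : HasFDerivAt (fun z => Real.exp (μ * z.2) * ((1 + 2 * c * z.1) * (dt φ z + dx φ z) ^ 2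
        + 2 * (dt φ z - dx φ z) ^ 2 + φ z ^ 2)) _ z :=
    he.mul (((hw.mul ha).add (hb.const_mul 2)).add (h0.pow 2))
  have hs := dt_dx_comm hφ z
  rw [dx, dt, e1.fderiv, e2.fderiv]
  simp only [box, Pi.add_apply, Pi.sub_apply]
  simp only [dx, dt] at hs ⊢
  simp only [add_apply, sub_apply, smul_apply, smul_eq_mul, ContinuousLinearMap.coe_fst',
    ContinuousLinearMap.coe_snd', nsmul_eq_mul, hs]
  push_cast
  ring

/-- The pointwise coercivity of the divergence of the energy field. -/
theorem energy_density_ge {c L a b p f x : ℝ} (hc : 0 < c) (hx0 : 0 ≤ x) (hxL : x ≤ L) :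
    a ^ 2 + b ^ 2 + p ^ 2 - ((1 + 2 * c * L) ^ 2 + 4) * f ^ 2 ≤
      2 * ((1 + 2 * c * x) * a + 2 * b) * f
      + ((2 * c + 3) * (1 + 2 * c * x) - 2 * c) * a ^ 2
      + 2 * (2 * c + 3) * b ^ 2 + (2 * c + 3) * p ^ 2 + p * (a + b) := by
  have h1 : 0 ≤ (1 + 2 * c * x) := by positivity
  have h2 : (1 + 2 * c * x) ^ 2 ≤ (1 + 2 * c * L) ^ 2 := by gcongr
  have h3 : (1 + 2 * c * x) ^ 2 * f ^ 2 ≤ (1 + 2 * c * L) ^ 2 * f ^ 2 := by gcongr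
  have h4 : 0 ≤ (2 * c + 3) * (2 * c * x) * a ^ 2 := by positivity
  have h5 : 0 ≤ c * b ^ 2 := by positivity
  have h6 : 0 ≤ c * p ^ 2 := by positivity
  nlinarith [sq_nonneg ((1 + 2 * c * x) * f + a), sq_nonneg (2 * f + b), sq_nonneg (p + a),
    sq_nonneg (p + b), sq_nonneg a, sq_nonneg b, sq_nonneg p]

/-- The energy estimate for the backward problem, including the bound on the trace of `φ_x` at
the fixed end (hidden regularity). -/
theorem energy_estimate {k T : ℝ} (hk0 : 0 < k) (hk1 : k < 1) (hT : 0 < T) :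
    ∃ K : ℝ, 0 ≤ K ∧ ∀ φ : ℝ × ℝ → ℝ, ContDiff ℝ 2 φ → ZeroLeft T φ → ZeroRight k T φ →
      ZeroAt k T φ → ZeroAt k T (dt φ) →
      (∫ z in Q k T, (φ z ^ 2 + dx φ z ^ 2 + dt φ z ^ 2))
        + (∫ x in Ioo (0 : ℝ) 1, (φ (x, 0) ^ 2 + dx φ (x, 0) ^ 2 + dt φ (x, 0) ^ 2))
        + (∫ t in Ioo 0 T, dx φ (0, t) ^ 2) ≤ K * ∫ z in Q k T, box φ z ^ 2 := by
  obtain ⟨c, hc, hck⟩ : ∃ c : ℝ, 0 < c ∧ (1 - k) * c = 1 + k :=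
    ⟨(1 + k) / (1 - k), by apply div_pos <;> linarith, by
      field_simp [show (1 - k) ≠ 0 by linarith]⟩
  -- the weights: `w = exp (μ t) (1 + 2 c x)` on `φ_t + φ_x` and `v = 2 exp (μ t)` on `φ_t - φ_x`,
  -- so that `w < v` at the fixed end and `(1 + k) v ≤ (1 - k) w` at the moving end
  set μ := 2 * c + 3 with hμ
  set M := (1 + 2 * c * (1 + k * T)) ^ 2 + 4 with hM
  refine ⟨Real.exp (μ * T) * M, by positivity, fun φ hφ hl hr hf hft => ?_⟩
  have hφ1 : ContDiff ℝ 1 φ := hφ.of_le (by norm_num)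
  have hx := contDiff_one_dx hφ
  have ht := contDiff_one_dt hφ
  have cx := hx.continuous
  have ct := ht.continuous
  have c0 := hφ.continuous
  have cb := continuous_box hφ
  have hbd := isBounded_Q (T := T) hk0
  have hdiv := divergence_Q hk0 hT (X := fun z => Real.exp (μ * z.2) * (2 * (dt φ z - dx φ z) ^ 2
        - (1 + 2 * c * z.1) * (dt φ z + dx φ z) ^ 2))
    (Y := fun z => Real.exp (μ * z.2) * ((1 + 2 * c * z.1) * (dt φ z + dx φ z) ^ 2
        + 2 * (dt φ z - dx φ z) ^ 2 + φ z ^ 2)) (by fun_prop) (by fun_prop)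
  simp only [divergence_energy hφ] at hdiv
  have hkT : (0 : ℝ) ≤ 1 + k * T := by positivity
  have top : ∫ x in (0 : ℝ)..(1 + k * T), Real.exp (μ * T) * ((1 + 2 * c * x) *
      (dt φ (x, T) + dx φ (x, T)) ^ 2 + 2 * (dt φ (x, T) - dx φ (x, T)) ^ 2 + φ (x, T) ^ 2)
      = 0 := by
    rw [intervalIntegral.integral_of_le hkT, integral_Ioc_eq_integral_Ioo]
    refine setIntegral_eq_zero_of_forall_eq_zero fun x hx => ?_
    simp [hf x (Ioo_subset_Icc_self hx), hft x (Ioo_subset_Icc_self hx), hf.dx_eq_zero hφ1 hx]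
  have right : ∫ t in (0 : ℝ)..T, (Real.exp (μ * t) *
      (2 * (dt φ (1 + k * t, t) - dx φ (1 + k * t, t)) ^ 2 - (1 + 2 * c * (1 + k * t)) *
        (dt φ (1 + k * t, t) + dx φ (1 + k * t, t)) ^ 2) - k * (Real.exp (μ * t) *
      ((1 + 2 * c * (1 + k * t)) * (dt φ (1 + k * t, t) + dx φ (1 + k * t, t)) ^ 2
        + 2 * (dt φ (1 + k * t, t) - dx φ (1 + k * t, t)) ^ 2 + φ (1 + k * t, t) ^ 2))) ≤ 0 := by
    rw [intervalIntegral.integral_of_le hT.le, integral_Ioc_eq_integral_Ioo]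
    refine setIntegral_nonpos measurableSet_Ioo fun t h => ?_
    rw [hr.dt_eq hφ1 h, hr t (Ioo_subset_Icc_self h)]
    have h1 : 0 ≤ (1 - k) * (1 + k) * ((1 - k) * (1 + 2 * c * (k * t))) *
        (Real.exp (μ * t) * dx φ (1 + k * t, t) ^ 2) := by
      have := h.1
      have : 0 < 1 - k := by linarith
      positivity
    have e : ∀ E d : ℝ, E * (2 * (-k * d - d) ^ 2 - (1 + 2 * c * (1 + k * t)) * (-k * d + d) ^ 2)
        - k * (E * ((1 + 2 * c * (1 + k * t)) * (-k * d + d) ^ 2 + 2 * (-k * d - d) ^ 2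
          + (0 : ℝ) ^ 2)) =
        - ((1 - k) * (1 + k) * ((1 - k) * (1 + 2 * c * (k * t))) * (E * d ^ 2))
        + 2 * (1 - k) * (1 + k) * ((1 + k) - (1 - k) * c) * (E * d ^ 2) := by
      intro E d; ring
    rw [e, hck]
    linarith
  have left : ∫ t in Ioo 0 T, dx φ (0, t) ^ 2 ≤ ∫ t in (0 : ℝ)..T, (Real.exp (μ * t) *
      (2 * (dt φ (0, t) - dx φ (0, t)) ^ 2 - (1 + 2 * c * 0) *
        (dt φ (0, t) + dx φ (0, t)) ^ 2)) := by
    rw [intervalIntegral.integral_of_le hT.le, integral_Ioc_eq_integral_Ioo]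
    refine setIntegral_mono_on (Continuous.integrableOn_of_isBounded (by fun_prop)
      (Metric.isBounded_Ioo _ _)) (Continuous.integrableOn_of_isBounded (by fun_prop)
      (Metric.isBounded_Ioo _ _)) measurableSet_Ioo fun t h => ?_
    rw [hl.dt_eq_zero hφ1 h]
    have : 1 ≤ Real.exp (μ * t) := Real.one_le_exp (by have := h.1; positivity)
    nlinarith [sq_nonneg (dx φ (0, t))]
  have bottom : ∫ x in Ioo (0 : ℝ) 1, (φ (x, 0) ^ 2 + dx φ (x, 0) ^ 2 + dt φ (x, 0) ^ 2) ≤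
      ∫ x in (0 : ℝ)..1, Real.exp (μ * 0) * ((1 + 2 * c * x) *
      (dt φ (x, 0) + dx φ (x, 0)) ^ 2 + 2 * (dt φ (x, 0) - dx φ (x, 0)) ^ 2 + φ (x, 0) ^ 2) := by
    rw [intervalIntegral.integral_of_le zero_le_one, integral_Ioc_eq_integral_Ioo]
    refine setIntegral_mono_on (Continuous.integrableOn_of_isBounded (by fun_prop)
      (Metric.isBounded_Ioo _ _)) (Continuous.integrableOn_of_isBounded (by fun_prop)
      (Metric.isBounded_Ioo _ _)) measurableSet_Ioo fun x h => ?_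
    have h1 : 0 ≤ 2 * c * x * (dt φ (x, 0) + dx φ (x, 0)) ^ 2 := by
      have := h.1; positivity
    simp only [mul_zero, Real.exp_zero, one_mul]
    nlinarith [sq_nonneg (dt φ (x, 0) - dx φ (x, 0)), sq_nonneg (dt φ (x, 0) + dx φ (x, 0))]
  have bulk : (∫ z in Q k T, (φ z ^ 2 + dx φ z ^ 2 + dt φ z ^ 2))
      - Real.exp (μ * T) * M * (∫ z in Q k T, box φ z ^ 2) ≤
      ∫ z in Q k T, Real.exp (μ * z.2) * (2 * ((1 + 2 * c * z.1) * (dt φ z + dx φ z)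
        + 2 * (dt φ z - dx φ z)) * box φ z
      + (μ * (1 + 2 * c * z.1) - 2 * c) * (dt φ z + dx φ z) ^ 2
      + 2 * μ * (dt φ z - dx φ z) ^ 2 + μ * φ z ^ 2 + 2 * φ z * dt φ z) := by
    rw [← integral_const_mul, ← integral_sub
      (Continuous.integrableOn_of_isBounded (by fun_prop) hbd)
      (Continuous.integrableOn_of_isBounded (by fun_prop) hbd)]
    refine setIntegral_mono_on (Continuous.integrableOn_of_isBounded (by fun_prop) hbd)
      (Continuous.integrableOn_of_isBounded (by fun_prop) hbd)
      (isOpen_Q k T).measurableSet fun z hz => ?_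
    obtain ⟨z1, z2, z3, z4⟩ := hz
    have hE1 : 1 ≤ Real.exp (μ * z.2) := Real.one_le_exp (by positivity)
    have hE2 : Real.exp (μ * z.2) ≤ Real.exp (μ * T) := by gcongr
    have hL : z.1 ≤ 1 + k * T := by nlinarith
    have hD := energy_density_ge (c := c) (a := dt φ z + dx φ z) (b := dt φ z - dx φ z)
      (p := φ z) (f := box φ z) hc z3.le hL
    rw [← hM, ← hμ] at hD
    have hP : 0 ≤ M * box φ z ^ 2 := by positivity
    have hN : 0 ≤ (dt φ z + dx φ z) ^ 2 + (dt φ z - dx φ z) ^ 2 + φ z ^ 2 := by positivity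
    have h1 := mul_le_mul_of_nonneg_left hD (zero_le_one.trans hE1)
    have h2 := mul_le_mul_of_nonneg_right hE2 hP
    have h3 := mul_le_mul_of_nonneg_right hE1 hN
    calc φ z ^ 2 + dx φ z ^ 2 + dt φ z ^ 2 - Real.exp (μ * T) * M * box φ z ^ 2
        ≤ Real.exp (μ * z.2) * ((dt φ z + dx φ z) ^ 2 + (dt φ z - dx φ z) ^ 2 + φ z ^ 2
          - M * box φ z ^ 2) := by nlinarith [sq_nonneg (dx φ z), sq_nonneg (dt φ z)]
      _ ≤ _ := h1
      _ = _ := by ring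
  rw [top] at hdiv
  linarith

/-! ### Explicit solutions by the method of images -/

/-- The product of a function of the characteristic coordinate `t + r - x` and a function of the
characteristic coordinate `t + r + x`. -/
def charProd (r : ℝ) (F H : ℝ → ℝ) (z : ℝ × ℝ) : ℝ := F (z.2 + r - z.1) * H (z.2 + r + z.1)

theorem contDiff_charProd {n : WithTop ℕ∞} (r : ℝ) {F H : ℝ → ℝ} (hF : ContDiff ℝ n F)
    (hH : ContDiff ℝ n H) : ContDiff ℝ n (charProd r F H) := by
  unfold charProd
  fun_prop

theorem hasFDerivAt_charProd (r : ℝ) {F H : ℝ → ℝ} (hF : Differentiable ℝ F)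
    (hH : Differentiable ℝ H) (z : ℝ × ℝ) :
    HasFDerivAt (charProd r F H)
      (F (z.2 + r - z.1) • (deriv H (z.2 + r + z.1) •
          (ContinuousLinearMap.snd ℝ ℝ ℝ + ContinuousLinearMap.fst ℝ ℝ ℝ))
        + H (z.2 + r + z.1) • (deriv F (z.2 + r - z.1) •
          (ContinuousLinearMap.snd ℝ ℝ ℝ - ContinuousLinearMap.fst ℝ ℝ ℝ))) z := by
  have h1 : HasFDerivAt (fun z : ℝ × ℝ => z.2 + r - z.1) (ContinuousLinearMap.snd ℝ ℝ ℝ -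
      ContinuousLinearMap.fst ℝ ℝ ℝ) z := (hasFDerivAt_snd.add_const r).sub hasFDerivAt_fst
  have h2 : HasFDerivAt (fun z : ℝ × ℝ => z.2 + r + z.1) (ContinuousLinearMap.snd ℝ ℝ ℝ +
      ContinuousLinearMap.fst ℝ ℝ ℝ) z := (hasFDerivAt_snd.add_const r).add hasFDerivAt_fst
  exact ((hF _).hasDerivAt.comp_hasFDerivAt z h1).mul ((hH _).hasDerivAt.comp_hasFDerivAt z h2)

theorem dx_charProd (r : ℝ) {F H : ℝ → ℝ} (hF : Differentiable ℝ F) (hH : Differentiable ℝ H) :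
    dx (charProd r F H) = charProd r F (deriv H) + (-1 : ℝ) • charProd r (deriv F) H := by
  ext z
  rw [dx, (hasFDerivAt_charProd r hF hH z).fderiv]
  simp [charProd]
  ring

theorem dt_charProd (r : ℝ) {F H : ℝ → ℝ} (hF : Differentiable ℝ F) (hH : Differentiable ℝ H) :
    dt (charProd r F H) = charProd r F (deriv H) + charProd r (deriv F) H := by
  ext z
  rw [dt, (hasFDerivAt_charProd r hF hH z).fderiv]
  simp [charProd]
  ring

theorem box_charProd (r : ℝ) {F H : ℝ → ℝ} (hF : ContDiff ℝ 2 F) (hH : ContDiff ℝ 2 H) :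
    box (charProd r F H) = (4 : ℝ) • charProd r (deriv F) (deriv H) := by
  have hF' : ContDiff ℝ 1 (deriv F) := ContDiff.deriv' (n := 1) (by norm_num; exact hF)
  have hH' : ContDiff ℝ 1 (deriv H) := ContDiff.deriv' (n := 1) (by norm_num; exact hH)
  have dF := hF.differentiable (by simp)
  have dH := hH.differentiable (by simp)
  have dF' := hF'.differentiable (by simp)
  have dH' := hH'.differentiable (by simp)
  have c1 := contDiff_charProd r (hF.of_le (by norm_num)) hH'
  have c2 := contDiff_charProd r hF' (hH.of_le (by norm_num))
  have c2' : ContDiff ℝ 1 ((-1 : ℝ) • charProd r (deriv F) H) :=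
    c2.const_smul (-1 : ℝ)
  ext z
  rw [box, dx_charProd r dF dH, dt_charProd r dF dH, dt_add c1 c2, dx_add c1 c2', dx_smul _ c2, dx_charProd r dF dH', dx_charProd r dF' dH, dt_charProd r dF dH',
    dt_charProd r dF' dH]
  simp
  ring

/-- The superposition of the images of `A (t + r - x) B (t + r + x)` under the group generated by
the reflections in the two lateral boundaries: in characteristic coordinates `(ξ, η)` these are
the exchange of `ξ` and `η`, and its composition with the scaling `(ξ / c, c η)`. -/
def imageSum (r c : ℝ) (A B : ℝ → ℝ) (N : ℕ) (z : ℝ × ℝ) : ℝ :=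
  ∑ n ∈ Finset.range (2 * N + 1),
    (A ((z.2 + r - z.1) / c ^ ((n : ℤ) - N)) * B (c ^ ((n : ℤ) - N) * (z.2 + r + z.1))
      - A ((z.2 + r + z.1) / c ^ ((n : ℤ) - N)) * B (c ^ ((n : ℤ) - N) * (z.2 + r - z.1)))

theorem imageSum_eq (r c : ℝ) (A B : ℝ → ℝ) (N : ℕ) : imageSum r c A B N =
    ∑ n ∈ Finset.range (2 * N + 1),
      (charProd r (fun s => A (s / c ^ ((n : ℤ) - N))) (fun s => B (c ^ ((n : ℤ) - N) * s))
      + (-1 : ℝ) • charProd r (fun s => B (c ^ ((n : ℤ) - N) * s))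
          (fun s => A (s / c ^ ((n : ℤ) - N)))) := by
  ext z
  simp only [imageSum, charProd, Finset.sum_apply, Pi.add_apply, Pi.smul_apply, smul_eq_mul]
  refine Finset.sum_congr rfl fun n _ => ?_
  ring

theorem contDiff_imageSum (r c : ℝ) {A B : ℝ → ℝ} (hA : ContDiff ℝ 2 A) (hB : ContDiff ℝ 2 B)
    (N : ℕ) : ContDiff ℝ 2 (imageSum r c A B N) := by
  unfold imageSum
  fun_prop

theorem box_zero : box 0 = 0 := by
  have := box_smul 0 (φ := 0) contDiff_const
  simpa using this

theorem box_sum {ι : Type} (s : Finset ι) {f : ι → ℝ × ℝ → ℝ} (hf : ∀ i, ContDiff ℝ 2 (f i)) :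
    box (∑ i ∈ s, f i) = ∑ i ∈ s, box (f i) := by
  classical
  induction s using Finset.induction_on with
  | empty => simpa using box_zero
  | insert a s ha ih =>
    rw [Finset.sum_insert ha, Finset.sum_insert ha, box_add (hf a), ih]
    have := ContDiff.sum (s := s) (fun i _ => hf i)
    convert this using 1
    ext z
    simp

theorem box_imageSum (r : ℝ) {c : ℝ} (hc : 1 < c) {A B : ℝ → ℝ} (hA : ContDiff ℝ 2 A)
    (hB : ContDiff ℝ 2 B) (N : ℕ) (z : ℝ × ℝ) :
    box (imageSum r c A B N) z = 4 * imageSum r c (deriv A) (deriv B) N z := by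
  have h1 : ∀ l : ℝ, ContDiff ℝ 2 (fun s => A (s / l)) := fun l => by fun_prop
  have h2 : ∀ l : ℝ, ContDiff ℝ 2 (fun s => B (l * s)) := fun l => by fun_prop
  have d1 : ∀ l s : ℝ, deriv (fun s => A (s / l)) s = deriv A (s / l) / l := by
    intro l s
    simp only [div_eq_inv_mul]
    rw [deriv_comp_mul_left]
    simp
  have d2 : ∀ l s : ℝ, deriv (fun s => B (l * s)) s = l * deriv B (l * s) := by
    intro l s
    rw [deriv_comp_mul_left]
    simp
  have hs : ∀ n : ℕ, ContDiff ℝ 2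
      (charProd r (fun s => A (s / c ^ ((n : ℤ) - N))) (fun s => B (c ^ ((n : ℤ) - N) * s))
      + (-1 : ℝ) • charProd r (fun s => B (c ^ ((n : ℤ) - N) * s))
          (fun s => A (s / c ^ ((n : ℤ) - N)))) := fun n =>
    (contDiff_charProd r (h1 _) (h2 _)).add
      ((contDiff_charProd r (h2 _) (h1 _)).const_smul (-1 : ℝ))
  rw [imageSum_eq, box_sum _ hs, imageSum, Finset.mul_sum]
  simp only [Finset.sum_apply]
  refine Finset.sum_congr rfl fun n _ => ?_
  have hl : c ^ ((n : ℤ) - N) ≠ 0 := zpow_ne_zero _ (by linarith)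
  have h3 : ContDiff ℝ 2 ((-1 : ℝ) • charProd r (fun s => B (c ^ ((n : ℤ) - N) * s))
      (fun s => A (s / c ^ ((n : ℤ) - N)))) :=
    (contDiff_charProd r (h2 _) (h1 _)).const_smul (-1 : ℝ)
  rw [box_add (contDiff_charProd r (h1 _) (h2 _)) h3,
    box_smul _ (contDiff_charProd r (h2 _) (h1 _)), box_charProd r (h1 _) (h2 _),
    box_charProd r (h2 _) (h1 _)]
  simp only [charProd, Pi.add_apply, Pi.smul_apply, smul_eq_mul, d1, d2]
  field_simp
  ring

theorem zeroLeft_imageSum (r c T : ℝ) (A B : ℝ → ℝ) (N : ℕ) :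
    ZeroLeft T (imageSum r c A B N) := by
  intro t _
  simp [imageSum]

/-- On the line `η = c ξ` the images cancel in pairs, except for the two extreme ones. -/
theorem imageSum_moving_end (r : ℝ) {c : ℝ} (hc : 1 < c) (A B : ℝ → ℝ) (N : ℕ) {x t : ℝ}
    (h : t + r + x = c * (t + r - x)) :
    imageSum r c A B N (x, t) =
      A ((t + r - x) / c ^ N) * B (c ^ (N + 1) * (t + r - x))
        - A (c ^ (N + 1) * (t + r - x)) * B ((t + r - x) / c ^ N) := by
  have hc0 : c ≠ 0 := by linarith
  set s := t + r - x with hs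
  have hsum := Finset.sum_range_sub (fun n : ℕ =>
    A (c * s / c ^ ((n : ℤ) - N)) * B (c ^ ((n : ℤ) - N) * s)) (2 * N + 1)
  have e0 : c ^ (((0 : ℕ) : ℤ) - N) = (c ^ N)⁻¹ := by simp
  have e1 : c ^ (((2 * N + 1 : ℕ) : ℤ) - N) = c ^ (N + 1) := by
    rw [← zpow_natCast c (N + 1)]
    congr 1
    push_cast
    ring
  have e2 : ∀ n : ℕ, c ^ (((n + 1 : ℕ) : ℤ) - N) = c * c ^ ((n : ℤ) - N) := by
    intro n
    rw [← zpow_one_add₀ hc0]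
    congr 1
    push_cast
    ring
  rw [e0, e1] at hsum
  simp only [e2] at hsum
  simp only [imageSum, h, ← hs]
  have hN : c ^ N ≠ 0 := pow_ne_zero _ hc0
  rw [show s / c ^ N = c * s / c ^ (N + 1) by field_simp; ring, show c ^ (N + 1) * s =
    c * s / (c ^ N)⁻¹ by rw [div_inv_eq_mul]; ring, show c * s / (c ^ N)⁻¹ = c ^ (N + 1) * s by
    rw [div_inv_eq_mul]; ring]
  rw [show c * s / (c ^ N)⁻¹ = c ^ (N + 1) * s by rw [div_inv_eq_mul]; ring,
    show (c ^ N)⁻¹ * s = c * s / c ^ (N + 1) by field_simp; ring] at hsum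
  rw [← hsum]
  refine Finset.sum_congr rfl fun n _ => ?_
  have hl : c ^ ((n : ℤ) - N) ≠ 0 := zpow_ne_zero _ hc0
  rw [show c * s / (c * c ^ ((n : ℤ) - N)) = s / c ^ ((n : ℤ) - N) by field_simp,
    show c * c ^ ((n : ℤ) - N) * s = c ^ ((n : ℤ) - N) * (c * s) by ring]

theorem zpow_trichotomy {c : ℝ} (hc : 1 < c) (m : ℤ) :
    m = 0 ∨ c ≤ c ^ m ∨ c ^ m * c ≤ 1 := by
  rcases lt_trichotomy m 0 with h | h | h
  · right; right
    rw [← zpow_add_one₀ (by linarith)]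
    exact zpow_le_one_of_nonpos₀ hc.le (by omega)
  · exact Or.inl h
  · right; left
    calc c = c ^ (1 : ℤ) := (zpow_one c).symm
      _ ≤ c ^ m := zpow_le_zpow_right₀ hc.le (by omega)

/-- Inside the domain only the original source is felt: its images are supported outside. -/
theorem imageSum_inside {r c a₁ a₂ b₁ b₂ : ℝ} (hc : 1 < c) {α β : ℝ → ℝ}
    (h2 : a₂ < b₁) (h3 : b₂ < c * a₁) (hα : ∀ s, α s ≠ 0 → s ∈ Icc a₁ a₂)
    (hβ : ∀ s, β s ≠ 0 → s ∈ Icc b₁ b₂) (N : ℕ) {z : ℝ × ℝ} (hz0 : 0 < z.2 + r - z.1)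
    (hz1 : z.2 + r - z.1 < z.2 + r + z.1) (hz2 : z.2 + r + z.1 < c * (z.2 + r - z.1)) :
    imageSum r c α β N z = α (z.2 + r - z.1) * β (z.2 + r + z.1) := by
  set s := z.2 + r - z.1
  set q := z.2 + r + z.1
  have hin : ∀ s q, α s * β q ≠ 0 → s < q ∧ q < c * s := by
    intro s q h
    have hs := hα s (left_ne_zero_of_mul h)
    have hq := hβ q (right_ne_zero_of_mul h)
    exact ⟨by linarith [hs.2, hq.1], by nlinarith [hs.1, hq.2]⟩
  have hz : ∀ m : ℤ, m ≠ 0 → α (s / c ^ m) * β (c ^ m * q) = 0 := by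
    intro m hm
    by_contra h
    obtain ⟨h4, h5⟩ := hin _ _ h
    have hl : 0 < c ^ m := zpow_pos (by linarith) _
    rw [div_lt_iff₀ hl] at h4
    rw [← mul_div_assoc, lt_div_iff₀ hl] at h5
    rcases zpow_trichotomy hc m with h | h | h
    · exact hm h
    · nlinarith [mul_le_mul h h (by linarith) hl.le, mul_pos hl hl]
    · have h6 : c ^ m * c ^ m * c ≤ 1 := by nlinarith
      have h7 : c * s < c * (c ^ m * q * c ^ m) := by gcongr
      have h8 : c * (c ^ m * q * c ^ m) ≤ q := by nlinarith
      linarith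
  have hw : ∀ m : ℤ, α (q / c ^ m) * β (c ^ m * s) = 0 := by
    intro m
    by_contra h
    obtain ⟨h4, h5⟩ := hin _ _ h
    have hl : 0 < c ^ m := zpow_pos (by linarith) _
    rw [div_lt_iff₀ hl] at h4
    rw [← mul_div_assoc, lt_div_iff₀ hl] at h5
    have h6 : c ^ m ≤ 1 ∨ c ≤ c ^ m := by
      rcases zpow_trichotomy hc m with h | h | h
      · simp [h]
      · exact Or.inr h
      · left; nlinarith
    rcases h6 with h | h
    · have : c ^ m * s * c ^ m ≤ s := by
        have : c ^ m * c ^ m ≤ 1 := by nlinarith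
        nlinarith
      linarith
    · have : c * c * s ≤ c ^ m * s * c ^ m := by
        have : c * c ≤ c ^ m * c ^ m := by nlinarith
        nlinarith
      nlinarith
  simp only [imageSum]
  change ∑ n ∈ Finset.range (2 * N + 1), (α (s / c ^ ((n : ℤ) - N)) * β (c ^ ((n : ℤ) - N) * q)
      - α (q / c ^ ((n : ℤ) - N)) * β (c ^ ((n : ℤ) - N) * s)) = _
  simp only [hw, sub_zero]
  rw [Finset.sum_eq_single N]
  · simp
  · intro n _ hn
    exact hz _ (by omega)
  · intro h
    exact absurd (Finset.mem_range.2 (by omega)) h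

section Cone

variable {a b c l s q : ℝ}

/-- A source corner `(a, b)` in the sector does not lie beyond the image `(s / l, l q)` of a point
`(s, q)` of the sector that is later than the corner. -/
theorem image_after (hc : 1 < c) (hab : a < b) (hbc : b < c * a) (hsq : s ≤ q)
    (hqs : q ≤ c * s) (h : a + b ≤ s + q) (hl0 : 0 < l) (hl : l = 1 ∨ c ≤ l ∨ l * c ≤ 1) :
    a ≤ s / l ∨ b ≤ l * q := by
  rw [le_div_iff₀ hl0]
  by_contra! hn
  obtain ⟨h1, h2⟩ := hn
  have ha : 0 < a := by nlinarith
  rcases hl with rfl | hl | hl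
  · linarith
  · have : c * q ≤ l * q := mul_le_mul_of_nonneg_right hl (by linarith)
    nlinarith
  · have : c * s < a * (l * c) := by nlinarith
    have : a * (l * c) ≤ a := by nlinarith
    linarith

/-- The version of `image_after` for the images that exchange the characteristic coordinates. -/
theorem image_swap_after (hc : 1 < c) (hab : a < b) (hbc : b < c * a) (hs : 0 < s) (hsq : s ≤ q)
    (hqs : q ≤ c * s) (h : a + b ≤ s + q) (hl0 : 0 < l) (hl : c ≤ l ∨ l ≤ 1) :
    a ≤ q / l ∨ b ≤ l * s := by
  rw [le_div_iff₀ hl0]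
  by_contra! hn
  obtain ⟨h1, h2⟩ := hn
  have ha : 0 < a := by nlinarith
  rcases hl with hl | hl
  · have : c * s ≤ l * s := mul_le_mul_of_nonneg_right hl hs.le
    have : s < a := by nlinarith
    linarith
  · have : a * l ≤ a := by nlinarith
    linarith

/-- The time reversal of `image_after`. -/
theorem image_before (hc : 1 < c) (ha : 0 < a) (hab : a < b) (hbc : b < c * a) (hsq : s ≤ q)
    (hqs : q ≤ c * s) (h : s + q ≤ a + b) (hl0 : 0 < l) (hl : l = 1 ∨ c ≤ l ∨ l * c ≤ 1) :
    s / l ≤ a ∨ l * q ≤ b := by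
  rw [div_le_iff₀ hl0]
  by_contra! hn
  obtain ⟨h1, h2⟩ := hn
  rcases hl with rfl | hl | hl
  · linarith
  · have : a * c ≤ a * l := mul_le_mul_of_nonneg_left hl ha.le
    nlinarith
  · have hq : 0 < q := by
      by_contra! hq
      nlinarith
    have : c * b < q * (l * c) := by nlinarith
    have : q * (l * c) ≤ q := by nlinarith
    have : b < s := by nlinarith
    linarith

/-- The time reversal of `image_swap_after`. -/
theorem image_swap_before (hc : 1 < c) (ha : 0 < a) (hab : a < b) (hbc : b < c * a) (hs : 0 < s)
    (hsq : s ≤ q) (hqs : q ≤ c * s) (h : s + q ≤ a + b) (hl0 : 0 < l) (hl : c ≤ l ∨ l ≤ 1) :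
    q / l ≤ a ∨ l * s ≤ b := by
  rw [div_le_iff₀ hl0]
  by_contra! hn
  obtain ⟨h1, h2⟩ := hn
  rcases hl with hl | hl
  · have : a * c ≤ a * l := mul_le_mul_of_nonneg_left hl ha.le
    have : a < s := by nlinarith
    linarith
  · have : l * s ≤ s := by nlinarith
    linarith

end Cone

theorem zpow_dichotomy {c : ℝ} (hc : 1 < c) (m : ℤ) : c ≤ c ^ m ∨ c ^ m ≤ 1 := by
  have := zpow_pos (zero_lt_one.trans hc) m
  rcases zpow_trichotomy hc m with h | h | h
  · simp [h]
  · exact Or.inl h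
  · right; nlinarith

/-- Finite speed of propagation for the images: nothing is left once the source is over. -/
theorem imageSum_after {r c a b : ℝ} (hc : 1 < c) {A B : ℝ → ℝ} (hab : a < b) (hbc : b < c * a)
    (hA : ∀ s, a ≤ s → A s = 0) (hB : ∀ s, b ≤ s → B s = 0) (N : ℕ) {z : ℝ × ℝ}
    (hz0 : 0 < z.2 + r - z.1) (hz1 : z.2 + r - z.1 ≤ z.2 + r + z.1)
    (hz2 : z.2 + r + z.1 ≤ c * (z.2 + r - z.1)) (hz : a + b ≤ 2 * (z.2 + r)) :
    imageSum r c A B N z = 0 := by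
  have hP : ∀ s q, (a ≤ s ∨ b ≤ q) → A s * B q = 0 := by
    rintro s q (h | h)
    · simp [hA s h]
    · simp [hB q h]
  have hsum : a + b ≤ (z.2 + r - z.1) + (z.2 + r + z.1) := by linarith
  refine Finset.sum_eq_zero fun n _ => ?_
  have hl : 0 < c ^ ((n : ℤ) - N) := zpow_pos (by linarith) _
  rw [hP _ _ (image_after hc hab hbc hz1 hz2 hsum hl ((zpow_trichotomy hc _).imp_left
    fun h => by rw [h, zpow_zero])), hP _ _ (image_swap_after hc hab hbc hz0 hz1 hz2 hsum hl
    (zpow_dichotomy hc _)), sub_zero]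

/-- Finite speed of propagation for the images: there is nothing before the source starts. -/
theorem imageSum_before {r c a b : ℝ} (hc : 1 < c) {A B : ℝ → ℝ} (ha : 0 < a) (hab : a < b)
    (hbc : b < c * a) (hA : ∀ s, s ≤ a → A s = 0) (hB : ∀ s, s ≤ b → B s = 0) (N : ℕ)
    {z : ℝ × ℝ} (hz0 : 0 < z.2 + r - z.1) (hz1 : z.2 + r - z.1 ≤ z.2 + r + z.1)
    (hz2 : z.2 + r + z.1 ≤ c * (z.2 + r - z.1)) (hz : 2 * (z.2 + r) ≤ a + b) :
    imageSum r c A B N z = 0 := by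
  have hP : ∀ s q, (s ≤ a ∨ q ≤ b) → A s * B q = 0 := by
    rintro s q (h | h)
    · simp [hA s h]
    · simp [hB q h]
  have hsum : (z.2 + r - z.1) + (z.2 + r + z.1) ≤ a + b := by linarith
  refine Finset.sum_eq_zero fun n _ => ?_
  have hl : 0 < c ^ ((n : ℤ) - N) := zpow_pos (by linarith) _
  rw [hP _ _ (image_before hc ha hab hbc hz1 hz2 hsum hl ((zpow_trichotomy hc _).imp_left
    fun h => by rw [h, zpow_zero])), hP _ _ (image_swap_before hc ha hab hbc hz0 hz1 hz2 hsum hl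
    (zpow_dichotomy hc _)), sub_zero]

/-! ### Test functions with a prescribed d'Alembertian -/

/-- A `C¹` function has a `C²` primitive that vanishes at a given point `a`, hence also at every
point that is separated from `a` by no point where the function is nonzero. -/
theorem exists_primitive {α : ℝ → ℝ} (hα : ContDiff ℝ 1 α) (a : ℝ) :
    ∃ A : ℝ → ℝ, ContDiff ℝ 2 A ∧ deriv A = α ∧ ∀ s, (∀ u ∈ uIoc a s, α u = 0) → A s = 0 := by
  have hd : ∀ s, HasDerivAt (fun s => ∫ u in a..s, α u) (α s) s := fun s =>
    intervalIntegral.integral_hasDerivAt_right (hα.continuous.intervalIntegrable _ _)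
      (hα.continuous.stronglyMeasurableAtFilter _ _) hα.continuous.continuousAt
  have hD : deriv (fun s => ∫ u in a..s, α u) = α := funext fun s => (hd s).deriv
  refine ⟨fun s => ∫ u in a..s, α u, ?_, hD, fun s h => ?_⟩
  · rw [show (2 : WithTop ℕ∞) = 1 + 1 by norm_num, contDiff_succ_iff_deriv, hD]
    exact ⟨fun s => (hd s).differentiableAt, by simp, hα⟩
  · exact intervalIntegral.integral_zero_ae (Filter.Eventually.of_forall h)

/-- A one-sided version: it suffices that `φ(x, ·)` vanishes on one side of `t`, which is all that
is available at the corners of the domain. -/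
theorem dt_eq_zero_of_eventually {φ : ℝ × ℝ → ℝ} (hφ : ContDiff ℝ 2 φ) {x t : ℝ} {s : Set ℝ}
    (hs : UniqueDiffWithinAt ℝ s t) (ht : t ∈ s)
    (h : ∀ᶠ τ in nhdsWithin t s, φ (x, τ) = 0) : dt φ (x, t) = 0 := by
  have h1 : HasDerivAt (fun τ : ℝ => (x, τ)) ((0, 1) : ℝ × ℝ) t :=
    (hasDerivAt_const t x).prodMk (hasDerivAt_id t)
  have h2 : HasDerivAt (φ ∘ fun τ : ℝ => (x, τ)) (dt φ (x, t)) t :=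
    (hφ.differentiable (by simp) (x, t)).hasFDerivAt.comp_hasDerivAt t h1
  have h3 : HasDerivWithinAt (φ ∘ fun τ : ℝ => (x, τ)) 0 s t :=
    (hasDerivWithinAt_const t s (0 : ℝ)).congr_of_eventuallyEq h (h.self_of_nhdsWithin ht)
  exact hs.eq_deriv _ h2.hasDerivWithinAt h3

/-- The ratio `c = (1 + k) / (1 - k)`: with `ξ = t + 1/k - x` and `η = t + 1/k + x`, the moving end
is the line `η = c ξ`. -/
theorem exists_ratio {k : ℝ} (hk0 : 0 < k) (hk1 : k < 1) :
    ∃ c : ℝ, 1 < c ∧ (1 - k) * c = 1 + k := by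
  have h : 0 < 1 - k := by linarith
  exact ⟨(1 + k) / (1 - k), by rw [lt_div_iff₀ h]; linarith, by field_simp⟩

section Tests

variable {k c T : ℝ}

theorem cone_le (hk0 : 0 < k) (hk1 : k < 1) (hck : (1 - k) * c = 1 + k) {x t : ℝ}
    (hx : x ≤ 1 + k * t) : t + k⁻¹ + x ≤ c * (t + k⁻¹ - x) := by
  have h : 0 < 1 - k := by linarith
  have hkk : k * k⁻¹ = 1 := mul_inv_cancel₀ hk0.ne'
  refine le_of_mul_le_mul_left ?_ h
  have e : (1 - k) * (c * (t + k⁻¹ - x)) = (1 + k) * (t + k⁻¹ - x) := by rw [← hck]; ring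
  rw [e]
  nlinarith

theorem cone_lt (hk0 : 0 < k) (hk1 : k < 1) (hck : (1 - k) * c = 1 + k) {x t : ℝ}
    (hx : x < 1 + k * t) : t + k⁻¹ + x < c * (t + k⁻¹ - x) := by
  have h : 0 < 1 - k := by linarith
  have hkk : k * k⁻¹ = 1 := mul_inv_cancel₀ hk0.ne'
  refine lt_of_mul_lt_mul_left ?_ h.le
  have e : (1 - k) * (c * (t + k⁻¹ - x)) = (1 + k) * (t + k⁻¹ - x) := by rw [← hck]; ring
  rw [e]
  nlinarith

theorem cone_eq (hk0 : 0 < k) (hk1 : k < 1) (hck : (1 - k) * c = 1 + k) (t : ℝ) :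
    t + k⁻¹ + (1 + k * t) = c * (t + k⁻¹ - (1 + k * t)) := by
  have h : 1 - k ≠ 0 := by linarith
  have hkk : k * k⁻¹ = 1 := mul_inv_cancel₀ hk0.ne'
  refine mul_left_cancel₀ h ?_
  have e : (1 - k) * (c * (t + k⁻¹ - (1 + k * t))) = (1 + k) * (t + k⁻¹ - (1 + k * t)) := by
    rw [← hck]; ring
  rw [e]
  linear_combination (-2) * hkk

/-- The moving domain, down to `t = -1`, stays away from the vertex of the sector. -/
theorem cone_pos (hk0 : 0 < k) (hk1 : k < 1) {x t : ℝ} (hx : x ≤ 1 + k * t) (ht : -1 ≤ t) :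
    k⁻¹ * (1 - k) ^ 2 ≤ t + k⁻¹ - x := by
  have h : 0 < 1 - k := by linarith
  have hkk : k * k⁻¹ = 1 := mul_inv_cancel₀ hk0.ne'
  have e : k⁻¹ * (1 - k) ^ 2 = k⁻¹ - 2 * (k * k⁻¹) + k * (k * k⁻¹) := by ring
  rw [e, hkk]
  nlinarith

/-- Test functions of the backward problem with a product source. -/
theorem exists_backward_test (hk0 : 0 < k) (hk1 : k < 1) (hT : 0 < T)
    (hc : 1 < c) (hck : (1 - k) * c = 1 + k) {α β : ℝ → ℝ} (hα : ContDiff ℝ 1 α)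
    (hβ : ContDiff ℝ 1 β) {a₁ a₂ b₁ b₂ : ℝ} (ha : a₁ ≤ a₂) (hab : a₂ < b₁)
    (hb : b₁ ≤ b₂) (hba : b₂ < c * a₁) (hαs : ∀ s, α s ≠ 0 → s ∈ Icc a₁ a₂)
    (hβs : ∀ s, β s ≠ 0 → s ∈ Icc b₁ b₂) (hfin : a₂ + b₂ ≤ 2 * (T + k⁻¹)) :
    ∃ φ : ℝ × ℝ → ℝ, ContDiff ℝ 2 φ ∧ ZeroLeft T φ ∧ ZeroRight k T φ ∧ ZeroAt k T φ ∧
      ZeroAt k T (dt φ) ∧ ∀ z ∈ Q k T, box φ z = 4 * charProd k⁻¹ α β z := by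
  obtain ⟨A, hA, dA, zA⟩ := exists_primitive hα a₂
  obtain ⟨B, hB, dB, zB⟩ := exists_primitive hβ b₂
  have zA' : ∀ s, a₂ ≤ s → A s = 0 := fun s hs => zA s fun u hu => by
    by_contra h
    rw [uIoc_of_le hs] at hu
    linarith [(hαs u h).2, hu.1]
  have zB' : ∀ s, b₂ ≤ s → B s = 0 := fun s hs => zB s fun u hu => by
    by_contra h
    rw [uIoc_of_le hs] at hu
    linarith [(hβs u h).2, hu.1]
  set d := k⁻¹ * (1 - k) ^ 2 with hd
  have hd0 : 0 < d := by
    have : 0 < 1 - k := by linarith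
    positivity
  obtain ⟨N, hN⟩ := pow_unbounded_of_one_lt (b₂ / d) hc
  rw [div_lt_iff₀ hd0] at hN
  have hba' : b₂ < c * a₂ := hba.trans_le (by gcongr)
  have hzero : ∀ x t, 0 ≤ x → x ≤ 1 + k * t → T ≤ t → imageSum k⁻¹ c A B N (x, t) = 0 := by
    intro x t h0 h1 h2
    refine imageSum_after hc (hab.trans_le hb) hba' zA' zB' N
      (hd0.trans_le (cone_pos hk0 hk1 h1 (by linarith))) ?_ (cone_le hk0 hk1 hck h1) ?_
    · simp only; linarith
    · simp only; linarith
  refine ⟨imageSum k⁻¹ c A B N, contDiff_imageSum _ _ hA hB N, zeroLeft_imageSum _ _ _ _ _ _,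
    ?_, fun x hx => hzero x T hx.1 hx.2 le_rfl, ?_, ?_⟩
  · intro t ht
    rw [imageSum_moving_end _ hc _ _ _ (cone_eq hk0 hk1 hck t)]
    have h1 := cone_pos hk0 hk1 (le_refl (1 + k * t)) (by linarith [ht.1])
    have h2 : b₂ ≤ c ^ (N + 1) * (t + k⁻¹ - (1 + k * t)) := by
      calc b₂ ≤ c ^ N * d := hN.le
        _ ≤ c ^ (N + 1) * (t + k⁻¹ - (1 + k * t)) := by
          gcongr
          · exact hc.le
          · omega
    have h3 : a₂ ≤ b₂ := hab.le.trans hb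
    rw [zB' _ h2, zA' _ (h3.trans h2), mul_zero, zero_mul, sub_zero]
  · intro x hx
    refine dt_eq_zero_of_eventually (contDiff_imageSum _ _ hA hB N)
      (uniqueDiffOn_Ici T T self_mem_Ici) self_mem_Ici ?_
    filter_upwards [self_mem_nhdsWithin] with t ht
    exact hzero x t hx.1 (hx.2.trans (by gcongr; exact ht)) ht
  · rintro ⟨x, t⟩ ⟨h1, h2, h3, h4⟩
    simp only at h1 h2 h3 h4
    rw [box_imageSum _ hc hA hB, dA, dB, imageSum_inside hc hab hba hαs hβs N
      (hd0.trans_le (cone_pos hk0 hk1 h4.le (by linarith))) (by simp only; linarith)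
      (cone_lt hk0 hk1 hck h4), charProd]

/-- Test functions of the forward problem with a product source. -/
theorem exists_forward_test (hk0 : 0 < k) (hk1 : k < 1)
    (hc : 1 < c) (hck : (1 - k) * c = 1 + k) {α β : ℝ → ℝ} (hα : ContDiff ℝ 1 α)
    (hβ : ContDiff ℝ 1 β) {a₁ a₂ b₁ b₂ : ℝ} (ha0 : 0 < a₁) (ha : a₁ ≤ a₂) (hab : a₂ < b₁)
    (hb : b₁ ≤ b₂) (hba : b₂ < c * a₁) (hαs : ∀ s, α s ≠ 0 → s ∈ Icc a₁ a₂)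
    (hβs : ∀ s, β s ≠ 0 → s ∈ Icc b₁ b₂) (hini : 2 * k⁻¹ ≤ a₁ + b₁) :
    ∃ φ : ℝ × ℝ → ℝ, ContDiff ℝ 2 φ ∧ ZeroLeft T φ ∧ ZeroRight k T φ ∧ ZeroAt k 0 φ ∧
      (∀ x ∈ Ioo (0 : ℝ) 1, dt φ (x, 0) = 0) ∧
      ∀ z ∈ Q k T, box φ z = 4 * charProd k⁻¹ α β z := by
  obtain ⟨A, hA, dA, zA⟩ := exists_primitive hα a₁
  obtain ⟨B, hB, dB, zB⟩ := exists_primitive hβ b₁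
  -- the value of the source at the end points `a₁` and `b₁` themselves is `0` by continuity
  have hα1 : α a₁ = 0 := by
    refine (hα.continuous.continuousWithinAt (s := Iio a₁)).eq_const_of_mem_closure (by simp)
      fun s hs => ?_
    by_contra h
    exact absurd (hαs s h).1 (not_le.2 hs)
  have hβ1 : β b₁ = 0 := by
    refine (hβ.continuous.continuousWithinAt (s := Iio b₁)).eq_const_of_mem_closure (by simp)
      fun s hs => ?_
    by_contra h
    exact absurd (hβs s h).1 (not_le.2 hs)
  have zA' : ∀ s, s ≤ a₁ → A s = 0 := fun s hs => zA s fun u hu => by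
    by_contra h
    rw [uIoc_of_ge hs] at hu
    have := le_antisymm hu.2 (hαs u h).1
    exact h (this ▸ hα1)
  have zB' : ∀ s, s ≤ b₁ → B s = 0 := fun s hs => zB s fun u hu => by
    by_contra h
    rw [uIoc_of_ge hs] at hu
    have := le_antisymm hu.2 (hβs u h).1
    exact h (this ▸ hβ1)
  have hd0 : ∀ x t, x ≤ 1 + k * t → -1 ≤ t → 0 < t + k⁻¹ - x := fun x t hx ht => by
    have : 0 < 1 - k := by linarith
    exact lt_of_lt_of_le (by positivity) (cone_pos hk0 hk1 hx ht)
  obtain ⟨N, hN⟩ := pow_unbounded_of_one_lt ((T + k⁻¹) / a₁) hc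
  rw [div_lt_iff₀ ha0] at hN
  have hba' : b₁ < c * a₁ := hb.trans_lt hba
  have hzero : ∀ x t, 0 ≤ x → x ≤ 1 + k * t → t ≤ 0 → -1 ≤ t →
      imageSum k⁻¹ c A B N (x, t) = 0 := by
    intro x t h0 h1 h2 h3
    refine imageSum_before hc ha0 (ha.trans_lt hab) hba' zA' zB' N (hd0 x t h1 h3) ?_
      (cone_le hk0 hk1 hck h1) ?_
    · simp only; linarith
    · simp only; linarith
  refine ⟨imageSum k⁻¹ c A B N, contDiff_imageSum _ _ hA hB N, zeroLeft_imageSum _ _ _ _ _ _,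
    ?_, fun x hx => hzero x 0 hx.1 hx.2 le_rfl (by norm_num), ?_, ?_⟩
  · intro t ht
    rw [imageSum_moving_end _ hc _ _ _ (cone_eq hk0 hk1 hck t)]
    have h2 : (t + k⁻¹ - (1 + k * t)) / c ^ N ≤ a₁ := by
      rw [div_le_iff₀ (by positivity), mul_comm]
      have := mul_nonneg hk0.le ht.1
      linarith [ht.2]
    have h3 : a₁ ≤ b₁ := ha.trans hab.le
    rw [zA' _ h2, zB' _ (h2.trans h3), mul_zero, zero_mul, sub_zero]
  · intro x hx
    refine dt_eq_zero_of_eventually (contDiff_imageSum _ _ hA hB N)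
      (uniqueDiffOn_Iic 0 0 self_mem_Iic) self_mem_Iic ?_
    have h1 : ∀ᶠ t in nhds (0 : ℝ), x < 1 + k * t :=
      (continuousAt_const (y := x)).eventually_lt (by fun_prop) (by simpa using hx.2)
    filter_upwards [self_mem_nhdsWithin, nhdsWithin_le_nhds h1,
      nhdsWithin_le_nhds (Ioi_mem_nhds (show (-1 : ℝ) < 0 by norm_num))] with t ht h2 h3
    exact hzero x t hx.1.le h2.le ht (le_of_lt h3)
  · rintro ⟨x, t⟩ ⟨h1, h2, h3, h4⟩
    simp only at h1 h2 h3 h4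
    rw [box_imageSum _ hc hA hB, dA, dB, imageSum_inside hc hab hba hαs hβs N
      (hd0 _ _ h4.le (by linarith)) (by simp only; linarith)
      (cone_lt hk0 hk1 hck h4), charProd]

end Tests

/-! ### Density of the product sources -/

/-- The characteristic coordinates `(t - x, t + x)`. -/
def charEquiv : (ℝ × ℝ) ≃L[ℝ] (ℝ × ℝ) :=
  ContinuousLinearEquiv.equivOfInverse
    ((ContinuousLinearMap.snd ℝ ℝ ℝ - ContinuousLinearMap.fst ℝ ℝ ℝ).prod
      (ContinuousLinearMap.snd ℝ ℝ ℝ + ContinuousLinearMap.fst ℝ ℝ ℝ))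
    (((1 / 2 : ℝ) • (ContinuousLinearMap.snd ℝ ℝ ℝ - ContinuousLinearMap.fst ℝ ℝ ℝ)).prod
      ((1 / 2 : ℝ) • (ContinuousLinearMap.snd ℝ ℝ ℝ + ContinuousLinearMap.fst ℝ ℝ ℝ)))
    (fun z => by ext <;> simp <;> ring) (fun z => by ext <;> simp <;> ring)

theorem charEquiv_apply (z : ℝ × ℝ) : charEquiv z = (z.2 - z.1, z.2 + z.1) := rfl

/-- An integrable function that is orthogonal to all smooth products of bumps around a square has
zero integral over the square, where squares are meant in characteristic coordinates. -/
theorem integral_charSquare_eq_zero {v : ℝ × ℝ → ℝ} (hv : Integrable v) {r δ ε : ℝ} (hδ : 0 < δ)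
    (hε : 0 < ε) (p : ℝ × ℝ)
    (h : ∀ α β : ℝ → ℝ, ContDiff ℝ 1 α → ContDiff ℝ 1 β →
      (∀ s, α s ≠ 0 → |s - (p.1 + r)| ≤ δ + ε) → (∀ s, β s ≠ 0 → |s - (p.2 + r)| ≤ δ + ε) →
      ∫ z, v z * charProd r α β z = 0) :
    ∫ z in charEquiv ⁻¹' Metric.closedBall p δ, v z = 0 := by
  have hlt : ∀ n : ℕ, δ < δ + ε / (n + 1) := fun n => by
    have : 0 < ε / ((n : ℝ) + 1) := by positivity
    linarith
  have hle : ∀ n : ℕ, δ + ε / (n + 1) ≤ δ + ε := fun n => by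
    have : ε / ((n : ℝ) + 1) ≤ ε := div_le_self hε.le (by simp)
    linarith
  let α : ℕ → ContDiffBump (p.1 + r) := fun n => ⟨δ, δ + ε / (n + 1), hδ, hlt n⟩
  let β : ℕ → ContDiffBump (p.2 + r) := fun n => ⟨δ, δ + ε / (n + 1), hδ, hlt n⟩
  have hS : MeasurableSet (charEquiv ⁻¹' Metric.closedBall p δ) :=
    charEquiv.continuous.measurable Metric.isClosed_closedBall.measurableSet
  have hz : ∀ n, ∫ z, v z * charProd r (α n) (β n) z = 0 := by
    intro n
    refine h _ _ (α n).contDiff (β n).contDiff (fun s hs => ?_) (fun s hs => ?_)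
    · by_contra! h'
      exact hs ((α n).zero_of_le_dist ((hle n).trans h'.le))
    · by_contra! h'
      exact hs ((β n).zero_of_le_dist ((hle n).trans h'.le))
  have hlim : Filter.Tendsto (fun n => ∫ z, v z * charProd r (α n) (β n) z) Filter.atTop
      (nhds (∫ z, (charEquiv ⁻¹' Metric.closedBall p δ).indicator v z)) := by
    refine tendsto_integral_of_dominated_convergence (fun z => ‖v z‖) (fun n => ?_) hv.norm
      (fun n => ?_) ?_
    · exact hv.aestronglyMeasurable.mul (contDiff_charProd r (α n).contDiff
        (β n).contDiff (n := 1)).continuous.aestronglyMeasurable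
    · refine Filter.Eventually.of_forall fun z => ?_
      rw [norm_mul]
      refine mul_le_of_le_one_right (norm_nonneg _) ?_
      rw [charProd, Real.norm_of_nonneg (mul_nonneg (α n).nonneg (β n).nonneg)]
      exact mul_le_one₀ (α n).le_one (β n).nonneg (β n).le_one
    · refine Filter.Eventually.of_forall fun z => ?_
      have e1 : dist (z.2 + r - z.1) (p.1 + r) = dist (z.2 - z.1) p.1 := by
        rw [Real.dist_eq, Real.dist_eq]; congr 1; ring
      have e2 : dist (z.2 + r + z.1) (p.2 + r) = dist (z.2 + z.1) p.2 := by
        rw [Real.dist_eq, Real.dist_eq]; congr 1; ring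
      have hev : ∀ d : ℝ, δ < d → ∀ᶠ n : ℕ in Filter.atTop, δ + ε / (n + 1) ≤ d := by
        intro d hd
        have : Filter.Tendsto (fun n : ℕ => δ + ε / ((n : ℝ) + 1)) Filter.atTop (nhds δ) := by
          have := (tendsto_one_div_add_atTop_nhds_zero_nat (𝕜 := ℝ)).const_mul ε
          simpa [div_eq_mul_inv] using this.const_add δ
        exact (this.eventually_lt_const hd).mono fun n hn => hn.le
      by_cases hzS : z ∈ charEquiv ⁻¹' Metric.closedBall p δ
      · rw [indicator_of_mem hzS]
        rw [mem_preimage, charEquiv_apply, Metric.mem_closedBall, Prod.dist_eq, max_le_iff] at hzS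
        have : ∀ n, v z * charProd r (α n) (β n) z = v z := by
          intro n
          rw [charProd, (α n).one_of_mem_closedBall, (β n).one_of_mem_closedBall]
          · ring
          · rw [Metric.mem_closedBall, e2]; exact hzS.2
          · rw [Metric.mem_closedBall, e1]; exact hzS.1
        simp only [this]
        exact tendsto_const_nhds
      · rw [indicator_of_notMem hzS]
        rw [mem_preimage, charEquiv_apply, Metric.mem_closedBall, Prod.dist_eq, max_le_iff,
          not_and_or, not_le, not_le] at hzS
        refine tendsto_const_nhds.congr' ?_
        rcases hzS with hd | hd
        · filter_upwards [hev _ hd] with n hn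
          rw [charProd, (α n).zero_of_le_dist (by rw [e1]; exact hn)]
          ring
        · filter_upwards [hev _ hd] with n hn
          rw [charProd, (β n).zero_of_le_dist (by rw [e2]; exact hn)]
          ring
  simp only [hz] at hlim
  rw [← integral_indicator hS]
  exact (tendsto_nhds_unique hlim tendsto_const_nhds)

/-- An integrable function all of whose integrals over small characteristic squares centred in an
open set vanish is zero in that set, by Lebesgue's differentiation theorem. -/
theorem ae_eq_zero_of_charSquare {v : ℝ × ℝ → ℝ} (hv : Integrable v) {s : Set (ℝ × ℝ)}
    (h : ∀ z ∈ s, ∃ ε > 0, ∀ δ, 0 < δ → δ < ε →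
      ∫ y in charEquiv ⁻¹' Metric.closedBall (charEquiv z) δ, v y = 0) :
    ∀ᵐ z, z ∈ s → v z = 0 := by
  let e : (ℝ × ℝ) ≃ᵐ (ℝ × ℝ) := charEquiv.toHomeomorph.toMeasurableEquiv
  have he : ∀ z, e z = charEquiv z := fun _ => rfl
  let μ : Measure (ℝ × ℝ) := Measure.map charEquiv volume
  have hμ : μ = Measure.map e volume := rfl
  have : μ.IsAddHaarMeasure := charEquiv.isAddHaarMeasure_map volume
  have hU : Integrable (v ∘ e.symm) μ := by
    rw [hμ, integrable_map_equiv]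
    convert hv using 1
    ext z
    simp
  have hae := IsUnifLocDoublingMeasure.ae_tendsto_average μ hU.locallyIntegrable 1
  have hae' := ae_of_ae_map e.measurable.aemeasurable hae
  filter_upwards [hae'] with z hz hzs
  obtain ⟨ε, hε, hε'⟩ := h z hzs
  have h1 := hz (fun _ : ℝ => e z) (fun δ => δ) (l := nhdsWithin 0 (Ioi 0))
    Filter.tendsto_id (by
      filter_upwards [self_mem_nhdsWithin] with δ hδ
      simpa using (le_of_lt hδ))
  have h2 : (fun δ : ℝ => ⨍ y in Metric.closedBall (e z) δ, (v ∘ e.symm) y ∂μ)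
      =ᶠ[nhdsWithin 0 (Ioi 0)] fun _ => 0 := by
    filter_upwards [self_mem_nhdsWithin, nhdsWithin_le_nhds (Iio_mem_nhds hε)] with δ h0 h1
    have h3 := hε' δ h0 h1
    rw [setAverage_eq, hμ, e.measurableEmbedding.setIntegral_map]
    have : ∀ y, (v ∘ e.symm) (e y) = v y := fun y => by simp
    simp only [this]
    rw [show (e ⁻¹' Metric.closedBall (e z) δ) =
      charEquiv ⁻¹' Metric.closedBall (charEquiv z) δ from rfl, h3, smul_zero]
  have h3 := tendsto_nhds_unique (h1.congr' h2) tendsto_const_nhds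
  simpa using h3

/-- An integrable function on the moving domain that is orthogonal to all product sources is
zero. -/
theorem ae_eq_zero_of_charProd {k c T : ℝ} (hk0 : 0 < k) (hk1 : k < 1)
    (hck : (1 - k) * c = 1 + k) {u : ℝ × ℝ → ℝ} (hu : IntegrableOn u (Q k T))
    (h : ∀ (α β : ℝ → ℝ) (a₁ a₂ b₁ b₂ : ℝ), ContDiff ℝ 1 α → ContDiff ℝ 1 β → 0 < a₁ → a₁ ≤ a₂ →
      a₂ < b₁ → b₁ ≤ b₂ → b₂ < c * a₁ → (∀ s, α s ≠ 0 → s ∈ Icc a₁ a₂) →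
      (∀ s, β s ≠ 0 → s ∈ Icc b₁ b₂) → 2 * k⁻¹ ≤ a₁ + b₁ → a₂ + b₂ ≤ 2 * (T + k⁻¹) →
      ∫ z in Q k T, u z * charProd k⁻¹ α β z = 0) :
    u =ᵐ[volume.restrict (Q k T)] 0 := by
  have hQ := (isOpen_Q k T).measurableSet
  have hv := hu.integrable_indicator hQ
  suffices hs : ∀ᵐ z, z ∈ Q k T → (Q k T).indicator u z = 0 by
    rw [Filter.EventuallyEq, ae_restrict_iff' hQ]
    filter_upwards [hs] with z hz hzQ
    simpa [hzQ] using hz hzQ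
  refine ae_eq_zero_of_charSquare hv ?_
  rintro ⟨x, t⟩ ⟨h1, h2, h3, h4⟩
  simp only at h1 h2 h3 h4
  have h5 := cone_lt hk0 hk1 hck h4
  have h6 : 0 < t + k⁻¹ - x := by
    have : 0 < 1 - k := by linarith
    exact lt_of_lt_of_le (by positivity) (cone_pos hk0 hk1 h4.le (by linarith))
  obtain ⟨ε, hε, e1, e2, e3, e4, e5⟩ : ∃ ε > 0, 2 * ε < t + k⁻¹ - x ∧ 2 * ε < x ∧
      2 * ε * (1 + c) < c * (t + k⁻¹ - x) - (t + k⁻¹ + x) ∧ 2 * ε < t ∧ 2 * ε < T - t := by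
    have hev : ∀ C d : ℝ, 0 < d → ∀ᶠ ε in nhdsWithin (0 : ℝ) (Ioi 0), 2 * ε * C < d := by
      intro C d hd
      have : Filter.Tendsto (fun ε : ℝ => 2 * ε * C) (nhds 0) (nhds (2 * 0 * C)) :=
        Continuous.tendsto (by fun_prop) 0
      exact nhdsWithin_le_nhds (this.eventually_lt_const (by simpa using hd))
    obtain ⟨ε, a, b, c', d, e, f⟩ := (((hev 1 _ h6)).and ((hev 1 _ h3).and
      ((hev (1 + c) _ (sub_pos.2 h5)).and ((hev 1 _ h1).and ((hev 1 _ (sub_pos.2 h2)).and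
        self_mem_nhdsWithin))))).exists
    exact ⟨ε, f, by linarith, by linarith, by linarith, by linarith, by linarith⟩
  refine ⟨ε, hε, fun δ hδ hδε => ?_⟩
  refine integral_charSquare_eq_zero hv (r := k⁻¹) hδ hε _ fun α β hα hβ hαs hβs => ?_
  rw [charEquiv_apply] at hαs hβs
  simp only at hαs hβs
  have e6 : ∀ z, (Q k T).indicator u z * charProd k⁻¹ α β z =
      (Q k T).indicator (fun z => u z * charProd k⁻¹ α β z) z := by
    intro z
    by_cases hz : z ∈ Q k T <;> simp [hz]
  simp only [e6]
  rw [integral_indicator hQ]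
  refine h α β (t + k⁻¹ - x - 2 * ε) (t + k⁻¹ - x + 2 * ε) (t + k⁻¹ + x - 2 * ε)
    (t + k⁻¹ + x + 2 * ε) hα hβ (by linarith) (by linarith) (by linarith) (by linarith)
    (by nlinarith) (fun s hs => ?_) (fun s hs => ?_) (by linarith) (by linarith)
  · have := abs_le.1 (hαs s hs)
    exact ⟨by linarith [this.1], by linarith [this.2]⟩
  · have := abs_le.1 (hβs s hs)
    exact ⟨by linarith [this.1], by linarith [this.2]⟩

/-! ### Continuous functions as elements of `L²` -/

section RestrictL2

variable {α : Type} [MetricSpace α] [ProperSpace α] [MeasureSpace α] [OpensMeasurableSpace α]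
  [IsFiniteMeasureOnCompacts (volume : Measure α)] {s : Set α}

/-- The class in `L²` of a continuous function on a bounded set. -/
def restrictL2 (hs : Bornology.IsBounded s) : C(α, ℝ) →ₗ[ℝ] L2 s where
  toFun v := (v.continuous.memLp_two_restrict hs).toLp v
  map_add' _ _ := rfl
  map_smul' _ _ := rfl

theorem coeFn_restrictL2 (hs : Bornology.IsBounded s) (v : C(α, ℝ)) :
    restrictL2 hs v =ᵐ[volume.restrict s] v :=
  MemLp.coeFn_toLp (v.continuous.memLp_two_restrict hs)

theorem inner_restrictL2 (hs : Bornology.IsBounded s) (u : L2 s) (v : C(α, ℝ)) :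
    inner ℝ u (restrictL2 hs v) = ∫ x in s, u x * v x := by
  rw [L2.inner_def]
  refine integral_congr_ae ?_
  filter_upwards [coeFn_restrictL2 hs v] with x hx
  simp [hx, mul_comm]

theorem norm_sq_restrictL2 (hs : Bornology.IsBounded s) (v : C(α, ℝ)) :
    ‖restrictL2 hs v‖ ^ 2 = ∫ x in s, v x ^ 2 := by
  rw [← real_inner_self_eq_norm_sq, inner_restrictL2]
  refine integral_congr_ae ?_
  filter_upwards [coeFn_restrictL2 hs v] with x hx
  rw [hx, sq]

theorem integrable_mul_continuous (hs : Bornology.IsBounded s) (u : L2 s) {v : α → ℝ}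
    (hv : Continuous v) : IntegrableOn (fun x => u x * v x) s :=
  (Lp.memLp u).integrable_mul (hv.memLp_two_restrict hs)

end RestrictL2

/-! ### The backward test functions and the adjoint solution operator -/

/-- The linear space of the test functions for the state. -/
def BackwardTest (k T : ℝ) : Submodule ℝ (ℝ × ℝ → ℝ) where
  carrier := {φ | ContDiff ℝ 2 φ ∧ ZeroLeft T φ ∧ ZeroRight k T φ ∧ ZeroAt k T φ ∧
    ZeroAt k T (dt φ)}
  zero_mem' := ⟨contDiff_const, fun _ _ => rfl, fun _ _ => rfl, fun _ _ => rfl,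
    fun _ _ => by simp [dt]⟩
  add_mem' := by
    rintro a b ⟨ha, a1, a2, a3, a4⟩ ⟨hb, b1, b2, b3, b4⟩
    refine ⟨ha.add hb, fun t ht => by simp [a1 t ht, b1 t ht],
      fun t ht => by simp [a2 t ht, b2 t ht], fun t ht => by simp [a3 t ht, b3 t ht],
      fun t ht => ?_⟩
    rw [dt_add (ha.of_le (by norm_num)) (hb.of_le (by norm_num))]
    simp [a4 t ht, b4 t ht]
  smul_mem' := by
    rintro c a ⟨ha, a1, a2, a3, a4⟩
    refine ⟨contDiff_const.smul ha, fun t ht => by simp [a1 t ht],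
      fun t ht => by simp [a2 t ht], fun t ht => by simp [a3 t ht], fun t ht => ?_⟩
    rw [dt_smul c (ha.of_le (by norm_num))]
    simp [a4 t ht]

namespace BackwardTest

variable {k T : ℝ}

theorem contDiff (φ : BackwardTest k T) : ContDiff ℝ 2 φ.1 := φ.2.1

theorem contDiff_one (φ : BackwardTest k T) : ContDiff ℝ 1 φ.1 := φ.2.1.of_le (by norm_num)

/-- The d'Alembertian of a test function. -/
def boxMap : BackwardTest k T →ₗ[ℝ] C(ℝ × ℝ, ℝ) where
  toFun φ := ⟨box φ.1, continuous_box (contDiff φ)⟩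
  map_add' φ ψ := by ext z; simp [box_add (contDiff φ) (contDiff ψ)]
  map_smul' c φ := by ext z; simp [box_smul c (contDiff φ)]

/-- A test function, as a continuous function. -/
def valMap : BackwardTest k T →ₗ[ℝ] C(ℝ × ℝ, ℝ) where
  toFun φ := ⟨φ.1, (contDiff φ).continuous⟩
  map_add' _ _ := rfl
  map_smul' _ _ := rfl

/-- The space derivative of a test function. -/
def dxMap : BackwardTest k T →ₗ[ℝ] C(ℝ × ℝ, ℝ) where
  toFun φ := ⟨dx φ.1, continuous_dx (contDiff_one φ)⟩
  map_add' φ ψ := by ext z; simp [dx_add (contDiff_one φ) (contDiff_one ψ)]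
  map_smul' c φ := by ext z; simp [dx_smul c (contDiff_one φ)]

/-- The time derivative of a test function. -/
def dtMap : BackwardTest k T →ₗ[ℝ] C(ℝ × ℝ, ℝ) where
  toFun φ := ⟨dt φ.1, continuous_dt (contDiff_one φ)⟩
  map_add' φ ψ := by ext z; simp [dt_add (contDiff_one φ) (contDiff_one ψ)]
  map_smul' c φ := by ext z; simp [dt_smul c (contDiff_one φ)]

/-- Composition with a continuous curve, as a linear map. -/
def _root_.MovingWave.alongMap (γ : C(ℝ, ℝ × ℝ)) : C(ℝ × ℝ, ℝ) →ₗ[ℝ] C(ℝ, ℝ) where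
  toFun v := v.comp γ
  map_add' _ _ := rfl
  map_smul' _ _ := rfl

/-- The fixed end of the domain, parametrized by time. -/
def _root_.MovingWave.leftEnd : C(ℝ, ℝ × ℝ) := ⟨fun t => (0, t), by fun_prop⟩

/-- The initial slice of the domain. -/
def _root_.MovingWave.bottom : C(ℝ, ℝ × ℝ) := ⟨fun x => (x, 0), by fun_prop⟩

/-- The d'Alembertian of a test function, in `L²(Q)`. -/
def boxL2 (hk : 0 < k) : BackwardTest k T →ₗ[ℝ] L2 (Q k T) :=
  restrictL2 (isBounded_Q hk) ∘ₗ boxMap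

/-- The triple `(φ, φ_x, φ_t)` in `L²(Q)` together with the trace of `φ_x` at the fixed end. -/
def gradL2 (hk : 0 < k) :
    BackwardTest k T →ₗ[ℝ] (L2 (Q k T) × L2 (Q k T) × L2 (Q k T)) × L2 (Ioo 0 T) :=
  ((restrictL2 (isBounded_Q hk) ∘ₗ valMap).prod
    ((restrictL2 (isBounded_Q hk) ∘ₗ dxMap).prod (restrictL2 (isBounded_Q hk) ∘ₗ dtMap))).prod
    (restrictL2 (Metric.isBounded_Ioo 0 T) ∘ₗ alongMap leftEnd ∘ₗ dxMap)

theorem boxL2_apply (hk : 0 < k) (φ : BackwardTest k T) :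
    boxL2 hk φ = restrictL2 (isBounded_Q hk) ⟨box φ.1, continuous_box (contDiff φ)⟩ := rfl

/-- The energy estimate in terms of `L²` norms. -/
theorem exists_norm_le (hk0 : 0 < k) (hk1 : k < 1) (hT : 0 < T) :
    ∃ C : ℝ, 0 ≤ C ∧ ∀ φ : BackwardTest k T, ‖gradL2 hk0 φ‖ ≤ C * ‖boxL2 hk0 φ‖ ∧
      ‖restrictL2 (Metric.isBounded_Ioo (0 : ℝ) 1) (alongMap bottom (valMap φ))‖
        ≤ C * ‖boxL2 hk0 φ‖ ∧
      ‖restrictL2 (Metric.isBounded_Ioo (0 : ℝ) 1) (alongMap bottom (dxMap φ))‖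
        ≤ C * ‖boxL2 hk0 φ‖ ∧
      ‖restrictL2 (Metric.isBounded_Ioo (0 : ℝ) 1) (alongMap bottom (dtMap φ))‖
        ≤ C * ‖boxL2 hk0 φ‖ := by
  obtain ⟨K, hK, h⟩ := energy_estimate hk0 hk1 hT
  refine ⟨Real.sqrt K, Real.sqrt_nonneg _, fun φ => ?_⟩
  have hφ := h φ.1 φ.2.1 φ.2.2.1 φ.2.2.2.1 φ.2.2.2.2.1 φ.2.2.2.2.2
  have hQ := isBounded_Q (T := T) hk0
  have c0 := (contDiff φ).continuous
  have cx := continuous_dx (contDiff_one φ)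
  have ct := continuous_dt (contDiff_one φ)
  have hI := Metric.isBounded_Ioo (0 : ℝ) 1
  have hb : ‖boxL2 hk0 φ‖ ^ 2 = ∫ z in Q k T, box φ.1 z ^ 2 := norm_sq_restrictL2 hQ _
  rw [← hb, integral_add, integral_add, integral_add, integral_add] at hφ
  rotate_left
  iterate 8 exact Continuous.integrableOn_of_isBounded (by fun_prop) (by assumption)
  have hJ := Metric.isBounded_Ioo 0 T
  have e1 : ∫ z in Q k T, φ.1 z ^ 2 = ‖restrictL2 hQ (valMap φ)‖ ^ 2 :=
    (norm_sq_restrictL2 hQ (valMap φ)).symm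
  have e2 : ∫ z in Q k T, dx φ.1 z ^ 2 = ‖restrictL2 hQ (dxMap φ)‖ ^ 2 :=
    (norm_sq_restrictL2 hQ (dxMap φ)).symm
  have e3 : ∫ z in Q k T, dt φ.1 z ^ 2 = ‖restrictL2 hQ (dtMap φ)‖ ^ 2 :=
    (norm_sq_restrictL2 hQ (dtMap φ)).symm
  have e4 : ∫ t in Ioo 0 T, dx φ.1 (0, t) ^ 2 =
      ‖restrictL2 hJ (alongMap leftEnd (dxMap φ))‖ ^ 2 :=
    (norm_sq_restrictL2 hJ (alongMap leftEnd (dxMap φ))).symm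
  have e5 : ∫ x in Ioo (0 : ℝ) 1, φ.1 (x, 0) ^ 2 =
      ‖restrictL2 hI (alongMap bottom (valMap φ))‖ ^ 2 :=
    (norm_sq_restrictL2 hI (alongMap bottom (valMap φ))).symm
  have e6 : ∫ x in Ioo (0 : ℝ) 1, dx φ.1 (x, 0) ^ 2 =
      ‖restrictL2 hI (alongMap bottom (dxMap φ))‖ ^ 2 :=
    (norm_sq_restrictL2 hI (alongMap bottom (dxMap φ))).symm
  have e7 : ∫ x in Ioo (0 : ℝ) 1, dt φ.1 (x, 0) ^ 2 =
      ‖restrictL2 hI (alongMap bottom (dtMap φ))‖ ^ 2 :=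
    (norm_sq_restrictL2 hI (alongMap bottom (dtMap φ))).symm
  rw [e1, e2, e3, e4, e5, e6, e7] at hφ
  have key : ∀ a : ℝ, a ^ 2 ≤ K * ‖boxL2 hk0 φ‖ ^ 2 → a ≤ Real.sqrt K * ‖boxL2 hk0 φ‖ := by
    intro a ha
    refine le_of_sq_le_sq ?_ (by positivity)
    rwa [mul_pow, Real.sq_sqrt hK]
  have hnorm : ‖gradL2 hk0 φ‖ = max (max ‖restrictL2 hQ (valMap φ)‖
      (max ‖restrictL2 hQ (dxMap φ)‖ ‖restrictL2 hQ (dtMap φ)‖))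
      ‖restrictL2 hJ (alongMap leftEnd (dxMap φ))‖ := rfl
  rw [hnorm, max_le_iff, max_le_iff, max_le_iff]
  have n1 := sq_nonneg ‖restrictL2 hQ (valMap φ)‖
  have n2 := sq_nonneg ‖restrictL2 hQ (dxMap φ)‖
  have n3 := sq_nonneg ‖restrictL2 hQ (dtMap φ)‖
  have n4 := sq_nonneg ‖restrictL2 hJ (alongMap leftEnd (dxMap φ))‖
  have n5 := sq_nonneg ‖restrictL2 hI (alongMap bottom (valMap φ))‖
  have n6 := sq_nonneg ‖restrictL2 hI (alongMap bottom (dxMap φ))‖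
  have n7 := sq_nonneg ‖restrictL2 hI (alongMap bottom (dtMap φ))‖
  exact ⟨⟨⟨key _ (by linarith), key _ (by linarith), key _ (by linarith)⟩, key _ (by linarith)⟩,
    key _ (by linarith), key _ (by linarith), key _ (by linarith)⟩

/-- The d'Alembertians of test functions are dense, since they contain all product sources. -/
theorem denseRange_boxL2 (hk0 : 0 < k) (hk1 : k < 1) (hT : 0 < T) :
    DenseRange (boxL2 (T := T) hk0) := by
  have : Dense ((LinearMap.range (boxL2 (T := T) hk0) : Submodule ℝ (L2 (Q k T))) :
      Set (L2 (Q k T))) := by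
    rw [Submodule.dense_iff_topologicalClosure_eq_top, Submodule.topologicalClosure_eq_top_iff,
      Submodule.eq_bot_iff]
    intro u hu
    obtain ⟨c, hc, hck⟩ := exists_ratio hk0 hk1
    have hfin : IsFiniteMeasure (volume.restrict (Q k T)) :=
      ⟨by simpa using (isBounded_Q hk0).measure_lt_top⟩
    rw [Lp.eq_zero_iff_ae_eq_zero]
    refine ae_eq_zero_of_charProd hk0 hk1 hck ((Lp.memLp u).integrable (by norm_num)) ?_
    intro α β a₁ a₂ b₁ b₂ hα hβ h1 h2 h3 h4 h5 h6 h7 _ h9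
    obtain ⟨φ, p1, p2, p3, p4, p5, hbox⟩ :=
      exists_backward_test hk0 hk1 hT hc hck hα hβ h2 h3 h4 h5 h6 h7 h9
    have := (Submodule.mem_orthogonal' _ _).1 hu _
      (LinearMap.mem_range_self (boxL2 hk0) ⟨φ, p1, p2, p3, p4, p5⟩)
    rw [boxL2_apply, inner_restrictL2] at this
    have e : ∫ z in Q k T, u z * box φ z = ∫ z in Q k T, 4 * (u z * charProd k⁻¹ α β z) :=
      setIntegral_congr_fun (isOpen_Q k T).measurableSet fun z hz => by
        simp only [hbox z hz]; ring
    simp only [ContinuousMap.coe_mk] at this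
    rw [e, integral_const_mul] at this
    linarith
  rwa [LinearMap.coe_range] at this

end BackwardTest

open BackwardTest

/-- The solution operator of the adjoint problem: the continuous extension of
`□φ ↦ ((φ, φ_x, φ_t), φ_x(0, ·))`. -/
def adjointOp {k T : ℝ} (hk : 0 < k) :
    L2 (Q k T) →L[ℝ] (L2 (Q k T) × L2 (Q k T) × L2 (Q k T)) × L2 (Ioo 0 T) :=
  (gradL2 hk).extendOfNorm (boxL2 hk)

section

variable {k T : ℝ}

theorem adjointOp_box (hk0 : 0 < k) (hk1 : k < 1) (hT : 0 < T) (φ : BackwardTest k T) :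
    adjointOp hk0 (boxL2 hk0 φ) = gradL2 hk0 φ := by
  obtain ⟨C, _, hC⟩ := exists_norm_le hk0 hk1 hT
  exact LinearMap.extendOfNorm_eq (denseRange_boxL2 hk0 hk1 hT) ⟨C, fun φ => (hC φ).1⟩ φ

theorem adjointOp_mem (hk0 : 0 < k) (hk1 : k < 1) (hT : 0 < T) (f : L2 (Q k T)) :
    (adjointOp hk0 f).1 ∈ AdjointSpace k T := by
  refine (denseRange_boxL2 hk0 hk1 hT).induction_on f ?_ fun φ => ?_
  · exact (AdjointSmooth k T).isClosed_topologicalClosure.preimage (by fun_prop)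
  · rw [adjointOp_box hk0 hk1 hT]
    exact Submodule.le_topologicalClosure _ ⟨φ.1, (contDiff_one φ), φ.2.2.1, φ.2.2.2.1,
      φ.2.2.2.2.1, coeFn_restrictL2 (isBounded_Q hk0) (valMap φ),
      coeFn_restrictL2 (isBounded_Q hk0) (dxMap φ), coeFn_restrictL2 (isBounded_Q hk0) (dtMap φ)⟩

/-- The weak form of the wave operator as a difference of inner products. -/
theorem weakForm_eq (hk : 0 < k) (p : L2 (Q k T) × L2 (Q k T) × L2 (Q k T)) {ψ : ℝ × ℝ → ℝ}
    (hψ : ContDiff ℝ 1 ψ) :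
    ∫ z in Q k T, (p.2.1 z * dx ψ z - p.2.2 z * dt ψ z) =
      inner ℝ p.2.1 (restrictL2 (isBounded_Q hk) ⟨dx ψ, continuous_dx hψ⟩)
        - inner ℝ p.2.2 (restrictL2 (isBounded_Q hk) ⟨dt ψ, continuous_dt hψ⟩) := by
  rw [inner_restrictL2, inner_restrictL2]
  exact integral_sub (integrable_mul_continuous (isBounded_Q hk) _ (continuous_dx hψ))
    (integrable_mul_continuous (isBounded_Q hk) _ (continuous_dt hψ))

/-- Green's formula for the solution operator of the adjoint problem. -/
theorem adjointOp_green (hk0 : 0 < k) (hk1 : k < 1) (hT : 0 < T) (f : L2 (Q k T))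
    {ψ : ℝ × ℝ → ℝ} (hψ : ContDiff ℝ 1 ψ) (hr : ZeroRight k T ψ) (hb : ZeroAt k 0 ψ) :
    (∫ z in Q k T, ((adjointOp hk0 f).1.2.1 z * dx ψ z - (adjointOp hk0 f).1.2.2 z * dt ψ z))
      + (∫ t in Ioo 0 T, (adjointOp hk0 f).2 t * ψ (0, t)) = ∫ z in Q k T, f z * ψ z := by
  have e1 : ∀ g : L2 (Ioo 0 T), ∫ t in Ioo 0 T, g t * ψ (0, t) =
      inner ℝ g (restrictL2 (Metric.isBounded_Ioo 0 T)
        (alongMap leftEnd ⟨ψ, hψ.continuous⟩)) := fun g =>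
    (inner_restrictL2 (Metric.isBounded_Ioo 0 T) g (alongMap leftEnd ⟨ψ, hψ.continuous⟩)).symm
  have e2 : ∀ f : L2 (Q k T), ∫ z in Q k T, f z * ψ z =
      inner ℝ f (restrictL2 (isBounded_Q hk0) ⟨ψ, hψ.continuous⟩) :=
    fun f => (inner_restrictL2 (isBounded_Q hk0) f ⟨ψ, hψ.continuous⟩).symm
  rw [weakForm_eq hk0 _ hψ, e1, e2]
  refine (denseRange_boxL2 hk0 hk1 hT).induction_on f ?_ fun φ => ?_
  · exact isClosed_eq (by fun_prop) (by fun_prop)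
  rw [← weakForm_eq hk0 _ hψ, ← e1, ← e2, adjointOp_box hk0 hk1 hT]
  have hg := green_Q hk0 hT (contDiff φ) hψ hr
  have hbot : ∫ x in (0 : ℝ)..1, dt φ.1 (x, 0) * ψ (x, 0) = 0 := by
    rw [intervalIntegral.integral_congr (g := fun _ => 0), intervalIntegral.integral_zero]
    intro x hx
    rw [uIcc_of_le zero_le_one] at hx
    simp [hb x (by simpa using hx)]
  have htop : ∫ x in (0 : ℝ)..(1 + k * T), dt φ.1 (x, T) * ψ (x, T) = 0 := by
    rw [intervalIntegral.integral_congr (g := fun _ => 0), intervalIntegral.integral_zero]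
    intro x hx
    rw [uIcc_of_le (by positivity)] at hx
    simp [φ.2.2.2.2.2 x hx]
  rw [hbot, htop, add_zero, sub_zero] at hg
  have i1 : ∫ z in Q k T, ((gradL2 hk0 φ).1.2.1 z * dx ψ z - (gradL2 hk0 φ).1.2.2 z * dt ψ z) =
      ∫ z in Q k T, (dx φ.1 z * dx ψ z - dt φ.1 z * dt ψ z) := by
    refine integral_congr_ae ?_
    filter_upwards [coeFn_restrictL2 (isBounded_Q hk0) (dxMap φ),
      coeFn_restrictL2 (isBounded_Q hk0) (dtMap φ)] with z h1 h2
    change restrictL2 (isBounded_Q hk0) (dxMap φ) z * _ -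
      restrictL2 (isBounded_Q hk0) (dtMap φ) z * _ = _
    rw [h1, h2]
    rfl
  have i2 : ∫ t in Ioo 0 T, (gradL2 hk0 φ).2 t * ψ (0, t) =
      ∫ t in Ioo 0 T, dx φ.1 (0, t) * ψ (0, t) := by
    refine integral_congr_ae ?_
    filter_upwards [coeFn_restrictL2 (Metric.isBounded_Ioo 0 T)
      (alongMap leftEnd (dxMap φ))] with t h1
    change restrictL2 (Metric.isBounded_Ioo 0 T) (alongMap leftEnd (dxMap φ)) t * _ = _
    rw [h1]
    rfl
  have i3 : ∫ z in Q k T, boxL2 hk0 φ z * ψ z = ∫ z in Q k T, box φ.1 z * ψ z := by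
    refine integral_congr_ae ?_
    filter_upwards [coeFn_restrictL2 (isBounded_Q hk0) (boxMap φ)] with z h1
    change restrictL2 (isBounded_Q hk0) (boxMap φ) z * _ = _
    rw [h1]
    rfl
  rw [i1, i2, i3, hg]

end

/-! ### Uniqueness of the adjoint state and of its normal derivative -/

section

variable {k T : ℝ}

theorem inner_restrictL2_of_ae (hk : 0 < k) {a : L2 (Q k T)} {f : ℝ × ℝ → ℝ}
    (h : a =ᵐ[volume.restrict (Q k T)] f) (v : C(ℝ × ℝ, ℝ)) :
    inner ℝ a (restrictL2 (isBounded_Q hk) v) = ∫ z in Q k T, f z * v z := by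
  rw [inner_restrictL2]
  refine integral_congr_ae ?_
  filter_upwards [h] with z hz
  rw [hz]

theorem AdjointSpace.subset_of_isClosed {t : Set (L2 (Q k T) × L2 (Q k T) × L2 (Q k T))}
    (h : (AdjointSmooth k T : Set _) ⊆ t) (ht : IsClosed t)
    {q : L2 (Q k T) × L2 (Q k T) × L2 (Q k T)} (hq : q ∈ AdjointSpace k T) : q ∈ t :=
  closure_minimal h ht hq

/-- Green's formula between the energy space and solutions of the forward problem. -/
theorem AdjointSpace.green_forward (hk : 0 < k) (hT : 0 < T)
    {q : L2 (Q k T) × L2 (Q k T) × L2 (Q k T)}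
    (hq : q ∈ AdjointSpace k T) {ψ : ℝ × ℝ → ℝ} (hψ : ContDiff ℝ 2 ψ)
    (hi : ∀ x ∈ Ioo (0 : ℝ) 1, dt ψ (x, 0) = 0) :
    ∫ z in Q k T, (q.2.1 z * dx ψ z - q.2.2 z * dt ψ z) =
      inner ℝ q.1 (restrictL2 (isBounded_Q hk) ⟨box ψ, continuous_box hψ⟩) := by
  have hψ1 : ContDiff ℝ 1 ψ := hψ.of_le (by norm_num)
  rw [weakForm_eq hk q hψ1]
  refine AdjointSpace.subset_of_isClosed (t := {q : L2 (Q k T) × L2 (Q k T) × L2 (Q k T) | inner ℝ q.2.1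
    (restrictL2 (isBounded_Q hk) ⟨dx ψ, continuous_dx hψ1⟩) - inner ℝ q.2.2
    (restrictL2 (isBounded_Q hk) ⟨dt ψ, continuous_dt hψ1⟩) =
    inner ℝ q.1 (restrictL2 (isBounded_Q hk) ⟨box ψ, continuous_box hψ⟩)}) ?_
    (isClosed_eq (by fun_prop) (by fun_prop)) hq
  rintro p ⟨φ, hφ, hl, hr, hf, h1, h2, h3⟩
  rw [mem_ofPred_eq, inner_restrictL2_of_ae hk h1, inner_restrictL2_of_ae hk h2,
    inner_restrictL2_of_ae hk h3, ← integral_sub]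
  rotate_left
  · exact Continuous.integrableOn_of_isBounded ((continuous_dx hφ).mul (continuous_dx hψ1))
      (isBounded_Q hk)
  · exact Continuous.integrableOn_of_isBounded ((continuous_dt hφ).mul (continuous_dt hψ1))
      (isBounded_Q hk)
  have hg := green_Q hk hT hψ hφ hr
  have hbot : ∫ x in (0 : ℝ)..1, dt ψ (x, 0) * φ (x, 0) = 0 := by
    rw [intervalIntegral.integral_of_le zero_le_one, integral_Ioc_eq_integral_Ioo]
    refine setIntegral_eq_zero_of_forall_eq_zero fun x hx => ?_
    simp [hi x hx]
  have htop : ∫ x in (0 : ℝ)..(1 + k * T), dt ψ (x, T) * φ (x, T) = 0 := by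
    rw [intervalIntegral.integral_congr (g := fun _ => 0), intervalIntegral.integral_zero]
    intro x hx
    rw [uIcc_of_le (by positivity)] at hx
    simp [hf x hx]
  have hleft : ∫ t in Ioo 0 T, dx ψ (0, t) * φ (0, t) = 0 := by
    refine setIntegral_eq_zero_of_forall_eq_zero fun t ht => ?_
    simp [hl t (Ioo_subset_Icc_self ht)]
  rw [hbot, htop, hleft] at hg
  simp only [ContinuousMap.coe_mk]
  simp only [mul_comm (dx φ _), mul_comm (dt φ _), mul_comm (φ _)]
  linarith

/-- The second component of an element of the energy space is the weak space derivative of the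
first one. -/
theorem AdjointSpace.inner_dx (hk : 0 < k) (hT : 0 < T)
    {q : L2 (Q k T) × L2 (Q k T) × L2 (Q k T)}
    (hq : q ∈ AdjointSpace k T) {g : ℝ × ℝ → ℝ} (hg : ContDiff ℝ 1 g)
    (hs : ∀ z ∉ Q k T, g z = 0) :
    inner ℝ q.2.1 (restrictL2 (isBounded_Q hk) ⟨g, hg.continuous⟩) =
      -inner ℝ q.1 (restrictL2 (isBounded_Q hk) ⟨dx g, continuous_dx hg⟩) := by
  refine AdjointSpace.subset_of_isClosed (t := {q : L2 (Q k T) × L2 (Q k T) × L2 (Q k T) | inner ℝ q.2.1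
    (restrictL2 (isBounded_Q hk) ⟨g, hg.continuous⟩) =
    -inner ℝ q.1 (restrictL2 (isBounded_Q hk) ⟨dx g, continuous_dx hg⟩)}) ?_
    (isClosed_eq (by fun_prop) (by fun_prop)) hq
  rintro p ⟨φ, hφ, -, -, -, h1, h2, -⟩
  rw [mem_ofPred_eq, inner_restrictL2_of_ae hk h1, inner_restrictL2_of_ae hk h2]
  have hd := divergence_Q hk hT (X := fun z => φ z * g z) (Y := fun _ => 0) (hφ.mul hg)
    contDiff_const
  have e : ∀ z, dx (fun z => φ z * g z) z + dt (fun _ => 0) z = dx φ z * g z + φ z * dx g z := by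
    intro z
    have := ((hφ.differentiable (by simp) z).hasFDerivAt.mul
      (hg.differentiable (by simp) z).hasFDerivAt).fderiv
    change fderiv ℝ (φ * g) z (1, 0) + _ = _
    rw [this]
    simp [dx, dt]
    ring
  have hl : ∀ t, g (0, t) = 0 := fun t => hs _ fun h => lt_irrefl _ h.2.2.1
  have hr : ∀ t, g (1 + k * t, t) = 0 := fun t => hs _ fun h => lt_irrefl _ h.2.2.2
  simp only [e, hl, hr] at hd
  have c1 : Continuous fun z => dx φ z * g z := (continuous_dx hφ).mul hg.continuous
  have c2 : Continuous fun z => φ z * dx g z := hφ.continuous.mul (continuous_dx hg)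
  rw [integral_add (c1.integrableOn_of_isBounded (isBounded_Q hk))
    (c2.integrableOn_of_isBounded (isBounded_Q hk))] at hd
  simp only [mul_zero, sub_zero, intervalIntegral.integral_zero, add_zero] at hd
  simp only [ContinuousMap.coe_mk]
  linarith

/-- The third component of an element of the energy space is the weak time derivative of the
first one. -/
theorem AdjointSpace.inner_dt (hk : 0 < k) (hT : 0 < T)
    {q : L2 (Q k T) × L2 (Q k T) × L2 (Q k T)}
    (hq : q ∈ AdjointSpace k T) {g : ℝ × ℝ → ℝ} (hg : ContDiff ℝ 1 g)
    (hs : ∀ z ∉ Q k T, g z = 0) :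
    inner ℝ q.2.2 (restrictL2 (isBounded_Q hk) ⟨g, hg.continuous⟩) =
      -inner ℝ q.1 (restrictL2 (isBounded_Q hk) ⟨dt g, continuous_dt hg⟩) := by
  refine AdjointSpace.subset_of_isClosed (t := {q : L2 (Q k T) × L2 (Q k T) × L2 (Q k T) | inner ℝ q.2.2
    (restrictL2 (isBounded_Q hk) ⟨g, hg.continuous⟩) =
    -inner ℝ q.1 (restrictL2 (isBounded_Q hk) ⟨dt g, continuous_dt hg⟩)}) ?_
    (isClosed_eq (by fun_prop) (by fun_prop)) hq
  rintro p ⟨φ, hφ, -, -, -, h1, -, h2⟩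
  rw [mem_ofPred_eq, inner_restrictL2_of_ae hk h1, inner_restrictL2_of_ae hk h2]
  have hd := divergence_Q hk hT (X := fun _ => 0) (Y := fun z => φ z * g z) contDiff_const
    (hφ.mul hg)
  have e : ∀ z, dx (fun _ => 0) z + dt (fun z => φ z * g z) z = dt φ z * g z + φ z * dt g z := by
    intro z
    have := ((hφ.differentiable (by simp) z).hasFDerivAt.mul
      (hg.differentiable (by simp) z).hasFDerivAt).fderiv
    change _ + fderiv ℝ (φ * g) z (0, 1) = _
    rw [this]
    simp [dx, dt]
    ring
  have hb : ∀ x, g (x, 0) = 0 := fun x => hs _ fun h => lt_irrefl _ h.1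
  have ht : ∀ x, g (x, T) = 0 := fun x => hs _ fun h => lt_irrefl _ h.2.1
  have hr : ∀ t, g (1 + k * t, t) = 0 := fun t => hs _ fun h => lt_irrefl _ h.2.2.2
  simp only [e, hb, ht, hr] at hd
  have c1 : Continuous fun z => dt φ z * g z := (continuous_dt hφ).mul hg.continuous
  have c2 : Continuous fun z => φ z * dt g z := hφ.continuous.mul (continuous_dt hg)
  rw [integral_add (c1.integrableOn_of_isBounded (isBounded_Q hk))
    (c2.integrableOn_of_isBounded (isBounded_Q hk))] at hd
  simp only [mul_zero, sub_zero, intervalIntegral.integral_zero, add_zero] at hd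
  simp only [ContinuousMap.coe_mk]
  linarith

/-- An element of `L²(Q)` orthogonal to the `C¹` functions vanishing outside `Q` is zero. -/
theorem eq_zero_of_inner_restrictL2 (hk : 0 < k) {a : L2 (Q k T)}
    (h : ∀ (g : ℝ × ℝ → ℝ) (hg : ContDiff ℝ 1 g), (∀ z ∉ Q k T, g z = 0) →
      inner ℝ a (restrictL2 (isBounded_Q hk) ⟨g, hg.continuous⟩) = 0) : a = 0 := by
  have hfin : IsFiniteMeasure (volume.restrict (Q k T)) :=
    ⟨by simpa using (isBounded_Q hk).measure_lt_top⟩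
  have ha : IntegrableOn a (Q k T) := (Lp.memLp a).integrable (by norm_num)
  rw [Lp.eq_zero_iff_ae_eq_zero, Filter.EventuallyEq,
    ae_restrict_iff' (isOpen_Q k T).measurableSet]
  refine (isOpen_Q k T).ae_eq_zero_of_integral_contDiff_smul_eq_zero ha.locallyIntegrableOn
    fun g hg _ hgs => ?_
  have hz : ∀ z ∉ Q k T, g z = 0 := fun z hz => image_eq_zero_of_notMem_tsupport fun h' =>
    hz (hgs h')
  have h1 := h g (hg.of_le (by simp)) hz
  rw [inner_restrictL2] at h1
  rw [← h1, ← setIntegral_eq_integral_of_forall_compl_eq_zero (s := Q k T)]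
  · simp [mul_comm]
  · intro z hzQ
    simp [hz z hzQ]

theorem AdjointSpace.eq_zero_of_fst (hk : 0 < k) (hT : 0 < T)
    {q : L2 (Q k T) × L2 (Q k T) × L2 (Q k T)} (hq : q ∈ AdjointSpace k T) (h : q.1 = 0) :
    q = 0 := by
  refine Prod.ext h (Prod.ext ?_ ?_)
  · refine eq_zero_of_inner_restrictL2 hk fun g hg hz => ?_
    rw [AdjointSpace.inner_dx hk hT hq hg hz, h, inner_zero_left, neg_zero]
  · refine eq_zero_of_inner_restrictL2 hk fun g hg hz => ?_
    rw [AdjointSpace.inner_dt hk hT hq hg hz, h, inner_zero_left, neg_zero]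

/-- Finite energy solutions of the adjoint problem are unique: test the difference with the
solutions of the forward problem. -/
theorem IsAdjointState.unique (hk0 : 0 < k) (hk1 : k < 1) (hT : 0 < T) {f : ℝ × ℝ → ℝ}
    {p p' : AdjointSpace k T} (hp : IsAdjointState k T f p) (hp' : IsAdjointState k T f p') :
    p = p' := by
  obtain ⟨c, hc, hck⟩ := exists_ratio hk0 hk1
  have hfin : IsFiniteMeasure (volume.restrict (Q k T)) :=
    ⟨by simpa using (isBounded_Q hk0).measure_lt_top⟩
  have hq := (p - p').2
  suffices h : (p - p').1.1 = 0 by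
    have := AdjointSpace.eq_zero_of_fst hk0 hT hq h
    exact sub_eq_zero.1 (Subtype.ext this)
  rw [Lp.eq_zero_iff_ae_eq_zero]
  refine ae_eq_zero_of_charProd hk0 hk1 hck ((Lp.memLp _).integrable (by norm_num)) ?_
  intro α β a₁ a₂ b₁ b₂ hα hβ h1 h2 h3 h4 h5 h6 h7 h8 _
  obtain ⟨ψ, hψ, p2, p3, p4, p5, hbox⟩ :=
    exists_forward_test (T := T) hk0 hk1 hc hck hα hβ h1 h2 h3 h4 h5 h6 h7 h8
  have hψ1 : ContDiff ℝ 1 ψ := hψ.of_le (by norm_num)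
  have e1 := AdjointSpace.green_forward hk0 hT hq hψ p5
  have e2 := hp ψ hψ1 p2 p3 p4
  rw [← hp' ψ hψ1 p2 p3 p4, weakForm_eq hk0 _ hψ1, weakForm_eq hk0 _ hψ1] at e2
  have e3 : (p - p').1 = p.1 - p'.1 := rfl
  rw [weakForm_eq hk0 _ hψ1, e3, Prod.snd_sub, Prod.fst_sub, Prod.snd_sub, inner_sub_left,
    inner_sub_left] at e1
  have e4 := inner_restrictL2 (isBounded_Q hk0) (p.1 - p'.1).1 ⟨box ψ, continuous_box hψ⟩
  have e : ∫ z in Q k T, (p.1 - p'.1).1 z * box ψ z =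
      ∫ z in Q k T, 4 * ((p.1 - p'.1).1 z * charProd k⁻¹ α β z) :=
    setIntegral_congr_fun (isOpen_Q k T).measurableSet fun z hz => by
      simp only [hbox z hz]; ring
  rw [integral_const_mul] at e
  simp only [ContinuousMap.coe_mk] at e4
  rw [e3]
  linarith

/-- The trace of the normal derivative is determined by Green's formula. -/
theorem IsTraceDx.unique (hk : 0 < k) {f : ℝ × ℝ → ℝ} {p : AdjointSpace k T}
    {g g' : L2 (Ioo 0 T)} (hg : IsTraceDx k T f p g) (hg' : IsTraceDx k T f p g') : g = g' := by
  have hint : ∀ g : L2 (Ioo 0 T), IntegrableOn g (Ioo 0 T) := fun g =>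
    (Lp.memLp g).integrable (by norm_num)
  let η : ContDiffBump (0 : ℝ) := ⟨1 / 4, 1 / 2, by norm_num, by norm_num⟩
  have hη0 : η 0 = 1 := η.one_of_mem_closedBall (by simp [η])
  refine Lp.ext ?_
  rw [Filter.EventuallyEq, ae_restrict_iff' measurableSet_Ioo]
  have h := isOpen_Ioo.ae_eq_zero_of_integral_contDiff_smul_eq_zero
    (f := fun t => g t - g' t) (μ := volume) (U := Ioo 0 T)
    ((hint g).sub (hint g')).locallyIntegrableOn fun β hβ _ hβs => ?_
  · filter_upwards [h] with t ht hts using sub_eq_zero.1 (ht hts)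
  have hβ0 : ∀ t ∉ Ioo 0 T, β t = 0 := fun t ht => image_eq_zero_of_notMem_tsupport fun h' =>
    ht (hβs h')
  have hψ : ContDiff ℝ 1 fun z : ℝ × ℝ => η z.1 * β z.2 := by
    have h1 : ContDiff ℝ 1 η := η.contDiff
    have h2 : ContDiff ℝ 1 β := hβ.of_le (by simp)
    fun_prop
  have hr : ZeroRight k T fun z : ℝ × ℝ => η z.1 * β z.2 := by
    intro t ht
    have : η (1 + k * t) = 0 := η.zero_of_le_dist (by
      have := mul_nonneg hk.le ht.1
      rw [Real.dist_eq, sub_zero, abs_of_nonneg (by linarith)]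
      simp only [η]
      linarith)
    simp [this]
  have hb : ZeroAt k 0 fun z : ℝ × ℝ => η z.1 * β z.2 := by
    intro x _
    simp [hβ0 0 (by simp)]
  have e1 := hg _ hψ hr hb
  rw [← hg' _ hψ hr hb] at e1
  have e2 := add_left_cancel e1
  simp only [hη0, one_mul] at e2
  have hc : Continuous β := hβ.continuous
  rw [← setIntegral_eq_integral_of_forall_compl_eq_zero (s := Ioo 0 T)
    (fun t ht => by simp [hβ0 t ht])]
  have e3 : ∀ t, β t • (g t - g' t) = g t * β t - g' t * β t := fun t => by
    rw [smul_eq_mul]; ring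
  simp only [e3]
  rw [integral_sub (integrable_mul_continuous (Metric.isBounded_Ioo 0 T) g hc)
    (integrable_mul_continuous (Metric.isBounded_Ioo 0 T) g' hc), e2, sub_self]

end

/-! ### The state -/

section

variable {k T : ℝ}

/-- A backward test function, as a test function for the state. -/
def BackwardTest.toStateTest (hT : 0 ≤ T) (φ : BackwardTest k T) : StateTest k T :=
  ⟨φ.1, φ.2.1, hT, φ.2.2.1, φ.2.2.2.1, φ.2.2.2.2.1, φ.2.2.2.2.2⟩

theorem coe_initial (hT : 0 ≤ T) (φ : BackwardTest k T) :
    ((toStateTest hT φ).initial : L2 (Ioo (0 : ℝ) 1) × L2 (Ioo (0 : ℝ) 1)) =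
      (restrictL2 (Metric.isBounded_Ioo 0 1) (alongMap bottom (valMap φ)),
        restrictL2 (Metric.isBounded_Ioo 0 1) (alongMap bottom (dxMap φ))) := by
  refine Prod.ext rfl ?_
  have hc : ContDiff ℝ 1 fun x : ℝ => φ.1 (x, 0) :=
    (contDiff_one φ).comp (contDiff_id.prodMk contDiff_const)
  refine MemLp.toLp_congr (memLp_of_continuous (hc.continuous_deriv le_rfl))
    ((alongMap bottom (dxMap φ)).continuous.memLp_two_restrict (Metric.isBounded_Ioo 0 1))
    (Filter.Eventually.of_forall fun x => ?_)
  have h1 : HasDerivAt (fun x : ℝ => (x, (0 : ℝ))) ((1, 0) : ℝ × ℝ) x :=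
    (hasDerivAt_id x).prodMk (hasDerivAt_const x 0)
  exact ((φ.2.1.differentiable (by simp) (x, 0)).hasFDerivAt.comp_hasDerivAt x h1).deriv

/-- The initial value `φ(·, 0) ∈ H¹₀(0,1)` as a linear function of `φ`. -/
def initialMap (hT : 0 ≤ T) : BackwardTest k T →ₗ[ℝ] H10 where
  toFun φ := (toStateTest hT φ).initial
  map_add' φ ψ := by
    refine Subtype.ext ?_
    rw [Submodule.coe_add, coe_initial, coe_initial, coe_initial]
    simp only [map_add, Prod.mk_add_mk]
  map_smul' c φ := by
    refine Subtype.ext ?_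
    rw [Submodule.coe_smul, coe_initial, coe_initial]
    simp only [map_smul, Prod.smul_mk, RingHom.id_apply]

/-- The contribution of the initial data to the transposition formula. -/
def dataFunctional (hT : 0 ≤ T) (u₀ : L2 (Ioo (0 : ℝ) 1)) (u₁ : HMinusOne) :
    BackwardTest k T →ₗ[ℝ] ℝ :=
  u₁.toLinearMap ∘ₗ initialMap hT - (innerSL ℝ u₀).toLinearMap ∘ₗ
    restrictL2 (Metric.isBounded_Ioo 0 1) ∘ₗ alongMap bottom ∘ₗ dtMap

theorem dataFunctional_apply (hT : 0 ≤ T) (u₀ : L2 (Ioo (0 : ℝ) 1)) (u₁ : HMinusOne)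
    (φ : BackwardTest k T) : dataFunctional hT u₀ u₁ φ =
      u₁ (toStateTest hT φ).initial - ∫ x in Ioo (0 : ℝ) 1, u₀ x * dt φ.1 (x, 0) := by
  change u₁ _ - inner ℝ u₀ (restrictL2 (Metric.isBounded_Ioo 0 1) (alongMap bottom (dtMap φ))) = _
  rw [inner_restrictL2]
  rfl

theorem exists_dataFunctional_le (hk0 : 0 < k) (hk1 : k < 1) (hT : 0 < T)
    (u₀ : L2 (Ioo (0 : ℝ) 1)) (u₁ : HMinusOne) :
    ∃ C, ∀ φ : BackwardTest k T, ‖dataFunctional hT.le u₀ u₁ φ‖ ≤ C * ‖boxL2 hk0 φ‖ := by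
  obtain ⟨C, hC, h⟩ := exists_norm_le hk0 hk1 hT
  refine ⟨‖u₁‖ * C + ‖u₀‖ * C, fun φ => ?_⟩
  obtain ⟨-, h1, h2, h3⟩ := h φ
  have e1 : ‖(toStateTest hT.le φ).initial‖ ≤ C * ‖boxL2 hk0 φ‖ := by
    change ‖((toStateTest hT.le φ).initial : L2 (Ioo (0 : ℝ) 1) × L2 (Ioo (0 : ℝ) 1))‖ ≤ _
    rw [coe_initial]
    exact max_le h1 h2
  change ‖u₁ (toStateTest hT.le φ).initial - inner ℝ u₀
    (restrictL2 (Metric.isBounded_Ioo 0 1) (alongMap bottom (dtMap φ)))‖ ≤ _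
  calc _ ≤ ‖u₁ (toStateTest hT.le φ).initial‖ + ‖inner ℝ u₀
        (restrictL2 (Metric.isBounded_Ioo 0 1) (alongMap bottom (dtMap φ)))‖ := norm_sub_le _ _
    _ ≤ ‖u₁‖ * (C * ‖boxL2 hk0 φ‖) + ‖u₀‖ * (C * ‖boxL2 hk0 φ‖) := by
      refine add_le_add ((u₁.le_opNorm _).trans (by gcongr)) ((norm_inner_le_norm _ _).trans ?_)
      gcongr
    _ = _ := by ring

/-- The state with zero boundary control: the Riesz representative of the data functional. -/
def dataState (hk : 0 < k) (hT : 0 ≤ T) (u₀ : L2 (Ioo (0 : ℝ) 1)) (u₁ : HMinusOne) :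
    L2 (Q k T) :=
  (InnerProductSpace.toDual ℝ _).symm ((dataFunctional hT u₀ u₁).extendOfNorm (boxL2 hk))

theorem inner_dataState (hk0 : 0 < k) (hk1 : k < 1) (hT : 0 < T)
    (u₀ : L2 (Ioo (0 : ℝ) 1)) (u₁ : HMinusOne) (φ : BackwardTest k T) :
    inner ℝ (dataState hk0 hT.le u₀ u₁) (boxL2 hk0 φ) = dataFunctional hT.le u₀ u₁ φ := by
  rw [dataState, InnerProductSpace.toDual_symm_apply,
    LinearMap.extendOfNorm_eq (denseRange_boxL2 hk0 hk1 hT)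
      (exists_dataFunctional_le hk0 hk1 hT u₀ u₁)]

/-- The operator sending the source of the adjoint problem to the trace at the fixed end of the
space derivative of the solution. -/
def traceOp (hk : 0 < k) : L2 (Q k T) →L[ℝ] L2 (Ioo 0 T) :=
  (ContinuousLinearMap.snd ℝ _ _).comp (adjointOp hk)

/-- The state is an affine function of the control, whose linear part is the adjoint of the trace
operator. -/
theorem isTranspositionSolution_iff (hk0 : 0 < k) (hk1 : k < 1) (hT : 0 < T)
    (u₀ : L2 (Ioo (0 : ℝ) 1)) (u₁ : HMinusOne) {w : ℝ → ℝ} {W : L2 (Ioo 0 T)}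
    (hw : ∀ v : C(ℝ, ℝ), ∫ t in Ioo 0 T, w t * v t =
      inner ℝ W (restrictL2 (Metric.isBounded_Ioo 0 T) v)) (u : L2 (Q k T)) :
    IsTranspositionSolution k T u₀ u₁ w u ↔
      u = dataState hk0 hT.le u₀ u₁ + (traceOp hk0).adjoint W := by
  have hctrl : ∀ φ : BackwardTest k T, inner ℝ ((traceOp hk0).adjoint W) (boxL2 hk0 φ) =
      ∫ t in Ioo 0 T, w t * dx φ.1 (0, t) := by
    intro φ
    rw [ContinuousLinearMap.adjoint_inner_left]
    change inner ℝ W (adjointOp hk0 (boxL2 hk0 φ)).2 = _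
    rw [adjointOp_box hk0 hk1 hT]
    exact (hw (alongMap leftEnd (dxMap φ))).symm
  have hbox : ∀ φ : BackwardTest k T, inner ℝ u (boxL2 hk0 φ) =
      ∫ z in Q k T, u z * box φ.1 z := fun φ => inner_restrictL2 (isBounded_Q hk0) u (boxMap φ)
  have hrhs : ∀ φ : BackwardTest k T,
      inner ℝ (dataState hk0 hT.le u₀ u₁ + (traceOp hk0).adjoint W) (boxL2 hk0 φ) =
      u₁ (toStateTest hT.le φ).initial - (∫ x in Ioo (0 : ℝ) 1, u₀ x * dt φ.1 (x, 0))
        + ∫ t in Ioo 0 T, w t * dx φ.1 (0, t) := fun φ => by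
    rw [inner_add_left, inner_dataState hk0 hk1 hT, hctrl, dataFunctional_apply]
  constructor
  · intro h
    refine (denseRange_boxL2 hk0 hk1 hT).eq_of_inner_left ℝ fun φ => ?_
    rw [hbox, hrhs]
    exact h (toStateTest hT.le φ)
  · intro h φ
    have e := hrhs ⟨φ.toFun, φ.smooth, φ.left, φ.right, φ.final, φ.final_dt⟩
    rw [← h, hbox] at e
    exact e

end

/-! ### Restriction of boundary functions -/

section Restriction

variable {S I : Set ℝ}

/-- Restriction of square integrable functions to a smaller set. -/
def restrictSet (h : S ⊆ I) : L2 I →L[ℝ] L2 S :=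
  LinearMap.mkContinuous
    { toFun := fun g => ((Lp.memLp g).mono_measure (Measure.restrict_mono h le_rfl)).toLp g
      map_add' := fun f g => by
        rw [← MemLp.toLp_add]
        exact MemLp.toLp_congr _ _ (ae_mono (Measure.restrict_mono h le_rfl) (Lp.coeFn_add f g))
      map_smul' := fun c f => by
        rw [RingHom.id_apply, ← MemLp.toLp_const_smul]
        exact MemLp.toLp_congr _ _ (ae_mono (Measure.restrict_mono h le_rfl) (Lp.coeFn_smul c f)) }
    1 fun g => by
      rw [one_mul]
      have hg : MemLp g 2 (volume.restrict S) :=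
        (Lp.memLp g).mono_measure (Measure.restrict_mono h le_rfl)
      refine (Lp.norm_toLp g hg).trans_le ?_
      rw [Lp.norm_def]
      exact ENNReal.toReal_mono (Lp.eLpNorm_ne_top g)
        (eLpNorm_mono_measure _ (Measure.restrict_mono h le_rfl))

theorem coeFn_restrictSet (h : S ⊆ I) (g : L2 I) :
    restrictSet h g =ᵐ[volume.restrict S] g :=
  MemLp.coeFn_toLp ((Lp.memLp g).mono_measure (Measure.restrict_mono h le_rfl))

theorem inner_restrictSet_adjoint (h : S ⊆ I) (hS : MeasurableSet S) (w : L2 S) (g : L2 I) :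
    inner ℝ ((restrictSet h).adjoint w) g = ∫ t in I, S.indicator w t * g t := by
  rw [ContinuousLinearMap.adjoint_inner_left, L2.inner_def]
  have e : ∀ t, S.indicator w t * g t = S.indicator (fun t => w t * g t) t := fun t => by
    by_cases ht : t ∈ S <;> simp [ht]
  simp only [e]
  rw [setIntegral_indicator hS, inter_eq_self_of_subset_right h]
  refine integral_congr_ae ?_
  filter_upwards [coeFn_restrictSet h g] with t ht
  simp [ht, mul_comm]

end Restriction

/-- Testing the boundary control against a continuous function. -/
theorem integral_boundaryControl {T : ℝ} {S₁ S₂ : Set ℝ} (hS₁ : MeasurableSet S₁)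
    (hS₂ : MeasurableSet S₂) (h₁ : S₁ ⊆ Ioo 0 T) (h₂ : S₂ ⊆ Ioo 0 T) (w₁ : L2 S₁) (w₂ : L2 S₂)
    {f : ℝ → ℝ} (hf : w₂ =ᵐ[volume.restrict S₂] f) (v : C(ℝ, ℝ)) :
    ∫ t in Ioo 0 T, boundaryControl S₁ S₂ w₁ f t * v t =
      inner ℝ ((restrictSet h₁).adjoint w₁ + (restrictSet h₂).adjoint w₂)
        (restrictL2 (Metric.isBounded_Ioo 0 T) v) := by
  have hv := coeFn_restrictL2 (Metric.isBounded_Ioo 0 T) v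
  have hint : ∀ {S : Set ℝ} (hS : MeasurableSet S) (h : S ⊆ Ioo 0 T) (w : L2 S),
      IntegrableOn (fun t => S.indicator w t *
        restrictL2 (Metric.isBounded_Ioo 0 T) v t) (Ioo 0 T) := by
    intro S hS h w
    refine MemLp.integrable_mul (p := 2) (q := 2) ?_ (Lp.memLp _)
    rw [memLp_indicator_iff_restrict hS, Measure.restrict_restrict hS,
      inter_eq_self_of_subset_left h]
    exact Lp.memLp w
  rw [inner_add_left, inner_restrictSet_adjoint h₁ hS₁, inner_restrictSet_adjoint h₂ hS₂,
    ← integral_add (hint hS₁ h₁ w₁) (hint hS₂ h₂ w₂)]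
  refine integral_congr_ae ?_
  have hf' := ae_restrict_of_ae (s := Ioo 0 T) ((ae_restrict_iff' hS₂).1 hf)
  filter_upwards [hv, hf'] with t h3 h4
  rw [h3, boundaryControl, add_mul]
  congr 2
  by_cases ht : t ∈ S₂ <;> simp [ht]
  exact (h4 ht).symm

/-! ### Quadratic minimization -/

section Quadratic

variable {H K : Type} [NormedAddCommGroup H] [InnerProductSpace ℝ H] [CompleteSpace H]
  [NormedAddCommGroup K] [InnerProductSpace ℝ K] [CompleteSpace K]

/-- The Euler equation of the quadratic functional `‖B w + d‖² / 2 + σ ‖w‖² / 2` has a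
solution. -/
theorem exists_euler (B : H →L[ℝ] K) (d : K) {σ : ℝ} (hσ : 0 < σ) :
    ∃ w : H, B.adjoint (B w + d) + σ • w = 0 := by
  let A : H →L[ℝ] H := σ • ContinuousLinearMap.id ℝ H + B.adjoint.comp B
  have hA : IsCoercive ((innerSL ℝ).comp A : H →L[ℝ] H →L[ℝ] ℝ) := by
    refine ⟨σ, hσ, fun u => ?_⟩
    have : inner ℝ (A u) u = σ * (‖u‖ * ‖u‖) + ‖B u‖ * ‖B u‖ := by
      simp only [A, add_apply, smul_apply, ContinuousLinearMap.id_apply,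
        ContinuousLinearMap.comp_apply, inner_add_left, real_inner_smul_left,
        ContinuousLinearMap.adjoint_inner_left, real_inner_self_eq_norm_mul_norm]
    simp only [ContinuousLinearMap.comp_apply, innerSL_apply_apply, this]
    nlinarith [mul_self_nonneg ‖B u‖]
  obtain ⟨w, hw⟩ := hA.continuousLinearEquivOfBilin.surjective (-(B.adjoint d))
  refine ⟨w, ?_⟩
  have hAw : A w = -(B.adjoint d) := by
    refine ext_inner_right ℝ fun v => ?_
    rw [← hw, IsCoercive.continuousLinearEquivOfBilin_apply]
    simp
  have : σ • w + B.adjoint (B w) = -(B.adjoint d) := hAw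
  rw [map_add, add_right_comm, add_comm (B.adjoint (B w)), this, neg_add_cancel]

/-- The quadratic functional is an exact parabola around a solution of the Euler equation. -/
theorem quadratic_expansion (B : H →L[ℝ] K) (d : K) {σ : ℝ} {w₀ : H}
    (h : B.adjoint (B w₀ + d) + σ • w₀ = 0) (w : H) :
    1 / 2 * ‖B w + d‖ ^ 2 + σ / 2 * ‖w‖ ^ 2 =
      1 / 2 * ‖B w₀ + d‖ ^ 2 + σ / 2 * ‖w₀‖ ^ 2
        + (1 / 2 * ‖B (w - w₀)‖ ^ 2 + σ / 2 * ‖w - w₀‖ ^ 2) := by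
  have h1 : inner ℝ (B w₀ + d) (B (w - w₀)) + σ * inner ℝ w₀ (w - w₀) = 0 := by
    rw [← ContinuousLinearMap.adjoint_inner_left, ← real_inner_smul_left, ← inner_add_left, h,
      inner_zero_left]
  have e1 : B w + d = (B w₀ + d) + B (w - w₀) := by rw [map_sub]; abel
  have e2 : ‖w‖ ^ 2 = ‖w₀‖ ^ 2 + 2 * inner ℝ w₀ (w - w₀) + ‖w - w₀‖ ^ 2 := by
    rw [← norm_add_sq_real, add_sub_cancel]
  rw [e1, e2, norm_add_sq_real (B w₀ + d)]
  linarith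

theorem eq_of_quadratic_le (B : H →L[ℝ] K) (d : K) {σ : ℝ} (hσ : 0 < σ) {w₀ : H}
    (h : B.adjoint (B w₀ + d) + σ • w₀ = 0) {w : H}
    (hw : 1 / 2 * ‖B w + d‖ ^ 2 + σ / 2 * ‖w‖ ^ 2 ≤
      1 / 2 * ‖B w₀ + d‖ ^ 2 + σ / 2 * ‖w₀‖ ^ 2) : w = w₀ := by
  rw [quadratic_expansion B d h] at hw
  have h1 : σ * ‖w - w₀‖ ^ 2 ≤ 0 := by nlinarith [sq_nonneg ‖B (w - w₀)‖]
  have h2 : ‖w - w₀‖ ^ 2 ≤ 0 := by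
    by_contra! h3
    nlinarith
  have h3 : ‖w - w₀‖ = 0 := by nlinarith [norm_nonneg (w - w₀)]
  exact sub_eq_zero.1 (norm_eq_zero.1 h3)

end Quadratic

/-! ### The optimality system -/

section

variable {k T σ : ℝ} {S₁ S₂ : Set ℝ}

theorem IsAdjointState.congr {f f' : ℝ × ℝ → ℝ} (h : f =ᵐ[volume.restrict (Q k T)] f')
    {p : AdjointSpace k T} (hp : IsAdjointState k T f p) : IsAdjointState k T f' p := by
  intro ψ h1 h2 h3 h4
  rw [hp ψ h1 h2 h3 h4]
  exact integral_congr_ae (h.mono fun z hz => by simp only [hz])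

theorem IsTraceDx.congr {f f' : ℝ × ℝ → ℝ} (h : f =ᵐ[volume.restrict (Q k T)] f')
    {p : AdjointSpace k T} {g : L2 (Ioo 0 T)} (hp : IsTraceDx k T f p g) :
    IsTraceDx k T f' p g := by
  intro ψ h1 h2 h3
  rw [hp ψ h1 h2 h3]
  exact integral_congr_ae (h.mono fun z hz => by simp only [hz])

/-- The adjoint state and its trace are the values of the solution operator. -/
theorem isAdjointState_and_isTraceDx_iff (hk0 : 0 < k) (hk1 : k < 1) (hT : 0 < T)
    (u u₂ : L2 (Q k T)) (p : AdjointSpace k T) (g : L2 (Ioo 0 T)) :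
    (IsAdjointState k T (fun z => u z - u₂ z) p ∧ IsTraceDx k T (fun z => u z - u₂ z) p g) ↔
      p.1 = (adjointOp hk0 (u - u₂)).1 ∧ g = traceOp hk0 (u - u₂) := by
  have hf : (u - u₂ : L2 (Q k T)) =ᵐ[volume.restrict (Q k T)] fun z => u z - u₂ z :=
    Lp.coeFn_sub u u₂
  let p₀ : AdjointSpace k T := ⟨(adjointOp hk0 (u - u₂)).1, adjointOp_mem hk0 hk1 hT _⟩
  have ht : IsTraceDx k T (fun z => u z - u₂ z) p₀ (traceOp hk0 (u - u₂)) :=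
    IsTraceDx.congr hf fun ψ h1 h2 h3 => adjointOp_green hk0 hk1 hT (u - u₂) h1 h2 h3
  have hp : IsAdjointState k T (fun z => u z - u₂ z) p₀ := by
    intro ψ h1 h2 h3 h4
    rw [← ht ψ h1 h3 h4, left_eq_add]
    refine setIntegral_eq_zero_of_forall_eq_zero fun t ht => ?_
    simp [h2 t (Ioo_subset_Icc_self ht)]
  constructor
  · rintro ⟨h1, h2⟩
    obtain rfl : p = p₀ := h1.unique hk0 hk1 hT hp
    exact ⟨rfl, h2.unique hk0 ht⟩
  · rintro ⟨h1, rfl⟩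
    obtain rfl : p = p₀ := Subtype.ext h1
    exact ⟨hp, ht⟩

/-- The linear part of the follower's control-to-state map. -/
def followerOp (hk : 0 < k) (h₂ : S₂ ⊆ Ioo 0 T) : L2 S₂ →L[ℝ] L2 (Q k T) :=
  (traceOp hk).adjoint.comp (restrictSet h₂).adjoint

/-- The state with a follower that does nothing. -/
def leaderState (hk : 0 < k) (hT : 0 ≤ T) (u₀ : L2 (Ioo (0 : ℝ) 1)) (u₁ : HMinusOne)
    (h₁ : S₁ ⊆ Ioo 0 T) (w₁ : L2 S₁) : L2 (Q k T) :=
  dataState hk hT u₀ u₁ + (traceOp hk).adjoint ((restrictSet h₁).adjoint w₁)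

theorem followerOp_adjoint (hk : 0 < k) (h₂ : S₂ ⊆ Ioo 0 T) (f : L2 (Q k T)) :
    (followerOp hk h₂).adjoint f = restrictSet h₂ (traceOp hk f) := by
  simp [followerOp, ContinuousLinearMap.adjoint_comp]

theorem isTranspositionSolution_control_iff (hk0 : 0 < k) (hk1 : k < 1) (hT : 0 < T)
    (hS₁ : MeasurableSet S₁) (hS₂ : MeasurableSet S₂) (h₁ : S₁ ⊆ Ioo 0 T) (h₂ : S₂ ⊆ Ioo 0 T)
    (u₀ : L2 (Ioo (0 : ℝ) 1)) (u₁ : HMinusOne) (w₁ : L2 S₁) (w₂ : L2 S₂) {f : ℝ → ℝ}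
    (hf : w₂ =ᵐ[volume.restrict S₂] f) (u : L2 (Q k T)) :
    IsTranspositionSolution k T u₀ u₁ (boundaryControl S₁ S₂ w₁ f) u ↔
      u = leaderState hk0 hT.le u₀ u₁ h₁ w₁ + followerOp hk0 h₂ w₂ := by
  rw [isTranspositionSolution_iff hk0 hk1 hT u₀ u₁
    (integral_boundaryControl hS₁ hS₂ h₁ h₂ w₁ w₂ hf), leaderState, followerOp,
    ContinuousLinearMap.comp_apply, map_add, add_assoc]

theorem state_eq (hk0 : 0 < k) (hk1 : k < 1) (hT : 0 < T)
    (hS₁ : MeasurableSet S₁) (hS₂ : MeasurableSet S₂) (h₁ : S₁ ⊆ Ioo 0 T) (h₂ : S₂ ⊆ Ioo 0 T)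
    (u₀ : L2 (Ioo (0 : ℝ) 1)) (u₁ : HMinusOne) (w₁ : L2 S₁) (w₂ : L2 S₂) :
    state k T S₁ S₂ u₀ u₁ w₁ w₂ =
      leaderState hk0 hT.le u₀ u₁ h₁ w₁ + followerOp hk0 h₂ w₂ := by
  have hiff := isTranspositionSolution_control_iff hk0 hk1 hT hS₁ hS₂ h₁ h₂ u₀ u₁ w₁ w₂
    (Filter.EventuallyEq.refl _ _)
  have h : ∃ u, IsTranspositionSolution k T u₀ u₁ (boundaryControl S₁ S₂ w₁ w₂) u :=
    ⟨_, (hiff _).2 rfl⟩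
  rw [state, dif_pos h]
  exact (hiff _).1 h.choose_spec

theorem integral_sq_eq {α : Type} [MeasureSpace α] {s : Set α} (f : L2 s) :
    ∫ x in s, f x ^ 2 = ‖f‖ ^ 2 := by
  rw [← real_inner_self_eq_norm_sq, L2.inner_def]
  simp [sq]

/-- The follower's cost is the sum of two squared norms. -/
theorem J₂_eq (hk0 : 0 < k) (hk1 : k < 1) (hT : 0 < T)
    (hS₁ : MeasurableSet S₁) (hS₂ : MeasurableSet S₂) (h₁ : S₁ ⊆ Ioo 0 T) (h₂ : S₂ ⊆ Ioo 0 T)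
    (u₀ : L2 (Ioo (0 : ℝ) 1)) (u₁ : HMinusOne) (u₂ : L2 (Q k T)) (w₁ : L2 S₁) (w₂ : L2 S₂) :
    J₂ k T σ S₁ S₂ u₀ u₁ u₂ w₁ w₂ =
      1 / 2 * ‖followerOp hk0 h₂ w₂ + (leaderState hk0 hT.le u₀ u₁ h₁ w₁ - u₂)‖ ^ 2
        + σ / 2 * ‖w₂‖ ^ 2 := by
  have e : ∫ z in Q k T, (state k T S₁ S₂ u₀ u₁ w₁ w₂ z - u₂ z) ^ 2 =
      ‖followerOp hk0 h₂ w₂ + (leaderState hk0 hT.le u₀ u₁ h₁ w₁ - u₂)‖ ^ 2 := by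
    rw [← add_sub_assoc, add_comm (followerOp hk0 h₂ w₂),
      ← state_eq hk0 hk1 hT hS₁ hS₂ h₁ h₂, ← integral_sq_eq]
    refine integral_congr_ae ?_
    filter_upwards [Lp.coeFn_sub (state k T S₁ S₂ u₀ u₁ w₁ w₂) u₂] with z hz
    rw [hz, Pi.sub_apply]
  rw [J₂, e, integral_sq_eq]

/-- The optimality system is the Euler equation of the follower's cost, for the control
`-(1/σ) g` on `S₂`. -/
theorem isOptimalitySystem_iff (hk0 : 0 < k) (hk1 : k < 1) (hT : 0 < T) (hσ : 0 < σ)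
    (hS₁ : MeasurableSet S₁) (hS₂ : MeasurableSet S₂) (h₁ : S₁ ⊆ Ioo 0 T) (h₂ : S₂ ⊆ Ioo 0 T)
    (u₀ : L2 (Ioo (0 : ℝ) 1)) (u₁ : HMinusOne) (u₂ : L2 (Q k T)) (w₁ : L2 S₁)
    (u : L2 (Q k T)) (p : AdjointSpace k T) (g : L2 (Ioo 0 T)) :
    IsOptimalitySystem k T σ S₁ S₂ u₀ u₁ u₂ w₁ u p g ↔
      ∃ w : L2 S₂, (followerOp hk0 h₂).adjoint (followerOp hk0 h₂ w +
          (leaderState hk0 hT.le u₀ u₁ h₁ w₁ - u₂)) + σ • w = 0 ∧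
        w =ᵐ[volume.restrict S₂] (fun t => 1 / σ * (-g t)) ∧
        u = leaderState hk0 hT.le u₀ u₁ h₁ w₁ + followerOp hk0 h₂ w ∧
        p.1 = (adjointOp hk0 (u - u₂)).1 ∧ g = traceOp hk0 (u - u₂) := by
  have hgen : ∀ w : L2 S₂, followerOp hk0 h₂ w + (leaderState hk0 hT.le u₀ u₁ h₁ w₁ - u₂) =
      leaderState hk0 hT.le u₀ u₁ h₁ w₁ + followerOp hk0 h₂ w - u₂ := fun w => by abel
  have hw : ∀ g : L2 (Ioo 0 T), ((-(1 / σ)) • restrictSet h₂ g : L2 S₂)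
      =ᵐ[volume.restrict S₂] fun t => 1 / σ * (-g t) := by
    intro g
    filter_upwards [Lp.coeFn_smul (-(1 / σ)) (restrictSet h₂ g), coeFn_restrictSet h₂ g]
      with t h3 h4
    rw [h3, Pi.smul_apply, h4, smul_eq_mul]
    ring
  rw [IsOptimalitySystem, ← and_assoc, isAdjointState_and_isTraceDx_iff hk0 hk1 hT]
  constructor
  · rintro ⟨⟨h3, h4⟩, h5⟩
    rw [isTranspositionSolution_control_iff hk0 hk1 hT hS₁ hS₂ h₁ h₂ u₀ u₁ w₁ _ (hw g)] at h5
    refine ⟨_, ?_, hw g, h5, h3, h4⟩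
    rw [hgen, ← h5, followerOp_adjoint, ← h4, smul_smul]
    have : σ * -(1 / σ) = -1 := by field_simp
    rw [this, neg_one_smul, add_neg_cancel]
  · rintro ⟨w, -, h4, h5, h6, h7⟩
    refine ⟨⟨h6, h7⟩, ?_⟩
    rw [isTranspositionSolution_control_iff hk0 hk1 hT hS₁ hS₂ h₁ h₂ u₀ u₁ w₁ w h4]
    exact h5

/-- A solution of the Euler equation is `-(1/σ)` times the trace produced by its own state. -/
theorem ae_eq_of_euler (hk : 0 < k) (hσ : 0 < σ) (h₂ : S₂ ⊆ Ioo 0 T) {f : L2 (Q k T)}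
    {w : L2 S₂} (h : (followerOp hk h₂).adjoint f + σ • w = 0) :
    w =ᵐ[volume.restrict S₂] fun t => 1 / σ * (-traceOp hk f t) := by
  rw [followerOp_adjoint] at h
  have hw : w = (-(1 / σ)) • restrictSet h₂ (traceOp hk f) := by
    rw [eq_neg_of_add_eq_zero_left h, smul_neg, smul_smul]
    have : -(1 / σ) * σ = -1 := by field_simp
    rw [this, neg_one_smul, neg_neg]
  filter_upwards [Lp.coeFn_smul (-(1 / σ)) (restrictSet h₂ (traceOp hk f)),
    coeFn_restrictSet h₂ (traceOp hk f)] with t h3 h4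
  rw [hw, h3, Pi.smul_apply, h4, smul_eq_mul]
  ring

end

end MovingWave

end

open MovingWave in
theorem theorem1 (k T σ : ℝ) (hk0 : 0 < k) (hk1 : k < 1) (hT : 0 < T) (hσ : 0 < σ)
    (S₁ S₂ : Set ℝ) (hS₁ : MeasurableSet S₁) (hS₂ : MeasurableSet S₂)
    (hS : S₁ ∪ S₂ = Set.Ioo 0 T)
    (u₀ : L2 (Set.Ioo (0 : ℝ) 1)) (u₁ : HMinusOne) (u₂ : L2 (Q k T)) (w₁ : L2 S₁) :
    -- for every follower there is exactly one state, so that `J₂` is well defined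
    (∀ w₂ : L2 S₂, ∃! u : L2 (Q k T),
      IsTranspositionSolution k T u₀ u₁ (boundaryControl S₁ S₂ w₁ w₂) u) ∧
    -- existence and uniqueness of the Nash equilibrium
    (∃! w₂ : L2 S₂, IsNashEquilibrium k T σ S₁ S₂ u₀ u₁ u₂ w₁ w₂) ∧
    -- existence and uniqueness for the optimality system
    (∃! upg : L2 (Q k T) × AdjointSpace k T × L2 (Set.Ioo 0 T),
      IsOptimalitySystem k T σ S₁ S₂ u₀ u₁ u₂ w₁ upg.1 upg.2.1 upg.2.2) ∧
    -- the Nash equilibrium is given by the solution of the optimality system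
    (∀ (w₂ : L2 S₂) (u : L2 (Q k T)) (p : AdjointSpace k T) (g : L2 (Set.Ioo 0 T)),
      IsNashEquilibrium k T σ S₁ S₂ u₀ u₁ u₂ w₁ w₂ →
      IsOptimalitySystem k T σ S₁ S₂ u₀ u₁ u₂ w₁ u p g →
        (∀ᵐ t ∂(MeasureTheory.volume.restrict S₂), w₂ t = 1 / σ * (-g t)) ∧
        u = state k T S₁ S₂ u₀ u₁ w₁ w₂) := by
  have h₁ : S₁ ⊆ Set.Ioo 0 T := hS ▸ Set.subset_union_left
  have h₂ : S₂ ⊆ Set.Ioo 0 T := hS ▸ Set.subset_union_right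
  obtain ⟨w₀, hw₀⟩ := exists_euler (followerOp hk0 h₂) (leaderState hk0 hT.le u₀ u₁ h₁ w₁ - u₂) hσ
  have hmin : IsNashEquilibrium k T σ S₁ S₂ u₀ u₁ u₂ w₁ w₀ := by
    intro w
    rw [J₂_eq hk0 hk1 hT hS₁ hS₂ h₁ h₂, J₂_eq hk0 hk1 hT hS₁ hS₂ h₁ h₂,
      quadratic_expansion _ _ hw₀ w]
    exact le_add_of_nonneg_right (by positivity)
  have huniq : ∀ w, IsNashEquilibrium k T σ S₁ S₂ u₀ u₁ u₂ w₁ w → w = w₀ := by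
    intro w hw
    have := hw w₀
    rw [J₂_eq hk0 hk1 hT hS₁ hS₂ h₁ h₂, J₂_eq hk0 hk1 hT hS₁ hS₂ h₁ h₂] at this
    exact eq_of_quadratic_le _ _ hσ hw₀ this
  -- two solutions of the Euler equation coincide, since each minimizes the cost
  have heuler : ∀ w, (followerOp hk0 h₂).adjoint (followerOp hk0 h₂ w +
      (leaderState hk0 hT.le u₀ u₁ h₁ w₁ - u₂)) + σ • w = 0 → w = w₀ := by
    intro w hw
    refine eq_of_quadratic_le _ _ hσ hw₀ ?_
    rw [quadratic_expansion _ _ hw w₀]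
    exact le_add_of_nonneg_right (by positivity)
  have hopt := isOptimalitySystem_iff hk0 hk1 hT hσ hS₁ hS₂ h₁ h₂ u₀ u₁ u₂ w₁
  refine ⟨fun w₂ => ?_, ⟨w₀, hmin, huniq⟩, ?_, ?_⟩
  · have hiff := isTranspositionSolution_control_iff hk0 hk1 hT hS₁ hS₂ h₁ h₂ u₀ u₁ w₁ w₂
      (Filter.EventuallyEq.refl _ _)
    exact ⟨_, (hiff _).2 rfl, fun u hu => (hiff u).1 hu⟩
  · let u := leaderState hk0 hT.le u₀ u₁ h₁ w₁ + followerOp hk0 h₂ w₀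
    refine ⟨(u, ⟨(adjointOp hk0 (u - u₂)).1, adjointOp_mem hk0 hk1 hT _⟩,
      traceOp hk0 (u - u₂)), ?_, ?_⟩
    · refine (hopt _ _ _).2 ⟨w₀, hw₀, ?_, rfl, rfl, rfl⟩
      refine ae_eq_of_euler hk0 hσ h₂ ?_
      rw [← hw₀]
      congr 2
      simp only [u]
      abel
    · rintro ⟨u', p', g'⟩ h
      obtain ⟨w, h3, -, h5, h6, h7⟩ := (hopt _ _ _).1 h
      obtain rfl := heuler w h3
      simp only at h5 h6 h7
      subst h5
      subst h7
      exact Prod.ext rfl (Prod.ext (Subtype.ext h6) rfl)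
  · intro w₂ u p g hN hO
    obtain ⟨w, h3, h4, h5, -, -⟩ := (hopt _ _ _).1 hO
    obtain rfl := heuler w h3
    obtain rfl := huniq w₂ hN
    exact ⟨h4, by rw [h5, state_eq hk0 hk1 hT hS₁ hS₂ h₁ h₂]⟩
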